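/- **Setting.** Let $d\ge 1$ and let $X\subset\mathbb R^d$ be a nonempty compact set with $\overline{\operatorname{int} X}=X$ such that $X$ is convex, or $\partial X$ is a smooth ($C^1$) hypersurface, or, more generally, there are $\alpha\in(0,\pi/2)$, $l>0$ such that every $x\in\partial X$ is the vertex of an open cone of half-angle $\alpha$ and side length $l$ contained in $\operatorname{int}X$. A *non-autonomous conformal iterated function system* (NCIFS) $\Phi$ on $X$ consists, for each $n\ge1$, of a countable index set $I^{(n)}$ and maps $\varphi^{(n)}_i:X\to X$ $(i\in I^{(n)})$ such that 1. $\varphi^{(n)}_a(\operatorname{int}X)\cap\varphi^{(n)}_b(\operatorname{int}X)=\emptyset$ for all $n$ and all $a\ne b$ in $I^{(n)}$; 2. there is an open connected set $V\supset X$ such that every $\varphi^{(n)}_i$ extends to a $C^1$ conformal diffeomorphism of $V$ into $V$; 3. there is $K\ge1$ such that every composition $\varphi=\varphi^{(k)}_{\omega_k}\circ\dots\circ\varphi^{(l)}_{\omega_l}$ $(k\le l$, $\omega_j\in I^{(j)})$ satisfies $|D\varphi(x)|\le K|D\varphi(y)|$ for all $x,y\in V$; 4. there is $\eta\in(0,1)$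 such that for all sufficiently large $m$, all $j\ge1$ and all $\varphi=\varphi^{(j)}_{\omega_j}\circ\dots\circ\varphi^{(j+m)}_{\omega_{j+m}}$ we have $|D\varphi(x)|\le\eta^m$ for all $x\in X$. Here $|D\varphi(x)|$ is the scaling factor of the derivative, and $\|D\varphi\|=\sup_{x\in X}|D\varphi(x)|$. For $\omega\in I^n=I^{(1)}\times\dots\times I^{(n)}$ put $\varphi_\omega=\varphi^{(1)}_{\omega_1}\circ\dots\circ\varphi^{(n)}_{\omega_n}$. The limit set is $J(\Phi)=\bigcap_{n\ge1}\bigcup_{\omega\in I^n}\varphi_\omega(X)$. Put $Z_n(t)=\sum_{\omega\in I^n}\|D\varphi_\omega\|^t$, $\underline P(t)=\liminf_{n\to\infty}\frac1n\log Z_n(t)\in[-\infty,\infty]$ and $Z_1^{(n)}(t)=\sum_{k\in I^{(n)}}\|D\varphi^{(n)}_k\|^t$. The *Bowen dimension* is $B(\Phi)=\sup\{t\ge0:\underline P(t)>0\}$ (with $\sup\emptyset=0$), and *Bowen's formula* holds for $\Phi$ if the Hausdorff dimension of $J(\Phi)$ equals $B(\Phi)$. The system is *infinite* if $I^{(n)}=\mathbb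 N=\{1,2,\dots\}$ for all $n$. * $\Phi\in\mathcal M$ if $\Phi$ is infinite and for all $t\in(0,d)$ and $\varepsilon>0$: (a) the sums $Z_1^{(n)}(t)$ are finite for all $n$ or infinite for all $n$; (b) if they are finite, then $\sum_{k\le e^{\varepsilon n}}\|D\varphi^{(n)}_k\|^t\big/Z_1^{(n)}(t)\to1$ as $n\to\infty$; (c) if they are infinite, then $\sum_{k\le e^{\varepsilon n}}\|D\varphi^{(n)}_k\|^t\to\infty$ as $n\to\infty$. * $\Phi\in\mathrm{EV}$ (*evenly varying*) if $\Phi$ is infinite and there are $\gamma_i>0$ $(i\in\mathbb N)$ and $c\ge1$ with $\gamma_i/c\le\|D\varphi^{(n)}_i\|\le c\,\gamma_i$ for all $i,n$. * $\Phi\in\mathcal M_+$ if every $I^{(n)}$ is a finite or infinite initial segment of $\mathbb N$; the functions $x\mapsto|D\varphi^{(n)}_a(x)|$ on $X$ are uniformly continuous, uniformly in $n$ and $a$; for each $a$, $\|D\varphi^{(n)}_a\|$ is bounded below by a positive constant over all $n$ with $a\in I^{(n)}$; and for all $t\in[0,d]$ and $\delta>0$ there is $M>0$ such that: the sums $Z_1^{(n)}(t)$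 are finite for all $n$ or infinite for all $n$; if finite, then $\sum_{k\le M}\|D\varphi^{(n)}_k\|^t\ge(1-\delta)Z_1^{(n)}(t)$ for all $n$; if infinite, then $\sum_{k\le M}\|D\varphi^{(n)}_k\|^t\ge1/\delta$ for all $n$. **Theorem.** Let $\Phi$ be an NCIFS on $X$. 1. If $\Phi\in\mathcal M$, then Bowen's formula holds for $\Phi$. 2. $\mathrm{EV}\subset\mathcal M$; hence Bowen's formula holds for every $\Phi\in\mathrm{EV}$. 3. Every infinite system in $\mathcal M_+$ belongs to $\mathcal M$, and Bowen's formula holds for every $\Phi\in\mathcal M_+$ (with finite or infinite alphabets). -/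

import Mathlib

open Set Filter Topology
open scoped NNReal ENNReal

noncomputable section

namespace NonAutonomous

/-- The ambient Euclidean space `ℝ^d`. -/
abbrev E (d : ℕ) : Type := EuclideanSpace ℝ (Fin d)

/-- The boundary of `X` is a (`C¹`-)smooth hypersurface: near each of its points it is the zero set
of a `C¹` function whose differential does not vanish at that point. -/
def HasSmoothBoundary {d : ℕ} (X : Set (E d)) : Prop :=
  ∀ p ∈ frontier X, ∃ (U : Set (E d)) (g : E d → ℝ), IsOpen U ∧ p ∈ U ∧
    ContDiffOn ℝ 1 g U ∧ fderiv ℝ g p ≠ 0 ∧ frontier X ∩ U = {x ∈ U | g x = 0}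

/-- The open cone with vertex `x`, axis in the direction of the unit vector `u`, half-angle `α`
and side length `l`. -/
def openCone {d : ℕ} (x u : E d) (α l : ℝ) : Set (E d) :=
  {y | 0 < ‖y - x‖ ∧ ‖y - x‖ < l ∧ Real.cos α * ‖y - x‖ < inner ℝ (y - x) u}

/-- The uniform interior cone condition: every boundary point of `X` is the vertex of a cone of
fixed opening angle and size that is contained in the interior of `X`. -/
def HasConeCondition {d : ℕ} (X : Set (E d)) : Prop :=
  ∃ α l : ℝ, 0 < α ∧ α < Real.pi / 2 ∧ 0 < l ∧
    ∀ x ∈ frontier X, ∃ u : E d, ‖u‖ = 1 ∧ openCone x u α l ⊆ interior X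

/-- The standing assumptions on the phase space `X`. -/
structure IsPhaseSpace {d : ℕ} (X : Set (E d)) : Prop where
  nonempty : X.Nonempty
  isCompact : IsCompact X
  closure_interior : closure (interior X) = X
  geometry : Convex ℝ X ∨ HasSmoothBoundary X ∨ HasConeCondition X

/-- Words `ω_m ω_{m+1} … ω_{m+n-1}` of length `n` starting at level `m`. -/
abbrev Word (I : ℕ → Set ℕ) (m n : ℕ) : Type := (j : Fin n) → I (m + j)

/-- The composition `φ_{ω_m} ∘ φ_{ω_{m+1}} ∘ … ∘ φ_{ω_{m+n-1}}` along a word of length `n` that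
starts at level `m`. -/
def wordMap {d : ℕ} (I : ℕ → Set ℕ) (φ : (n : ℕ) → I n → E d → E d) (m : ℕ) :
    (n : ℕ) → Word I m n → E d → E d
  | 0, _ => id
  | n + 1, ω => wordMap I φ m n (fun j => ω j.castSucc) ∘ φ (m + n) (ω (Fin.last n))

/-- A non-autonomous conformal iterated function system on `X`.

Levels are numbered from `0`, so that `index n` and `map n` are the alphabet `I^{(n+1)}` and the
family `Φ^{(n+1)}` of the usual numbering `n + 1 = 1, 2, 3, …`; the (countable) alphabets are sets
of natural numbers. The maps `X → X` are given together with their conformal extensions to `V`;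
values outside `V` play no role. -/
structure NCIFS {d : ℕ} (X : Set (E d)) where
  /-- The alphabets. -/
  index : ℕ → Set ℕ
  /-- The maps at each level. -/
  map : (n : ℕ) → index n → E d → E d
  /-- The common domain of the conformal extensions. -/
  V : Set (E d)
  isOpen_V : IsOpen V
  isConnected_V : IsConnected V
  subset_V : X ⊆ V
  mapsTo_X : ∀ n i, MapsTo (map n i) X X
  /-- The open set condition. -/
  open_set_condition : ∀ n, ∀ a b : index n, a ≠ b →
    Disjoint (map n a '' interior X) (map n b '' interior X)
  /-- Each map is a `C¹` conformal diffeomorphism of `V` into `V`. -/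
  mapsTo_V : ∀ n i, MapsTo (map n i) V V
  injOn_V : ∀ n i, InjOn (map n i) V
  contDiffOn_V : ∀ n i, ContDiffOn ℝ 1 (map n i) V
  conformalAt_V : ∀ n i, ∀ x ∈ V, ConformalAt (map n i) x
  /-- Bounded distortion. -/
  bounded_distortion : ∃ K : ℝ, 1 ≤ K ∧ ∀ (m n : ℕ) (ω : Word index m n), ∀ x ∈ V, ∀ y ∈ V,
    ‖fderiv ℝ (wordMap index map m n ω) x‖ ≤ K * ‖fderiv ℝ (wordMap index map m n ω) y‖
  /-- Uniform contraction along all sufficiently long words. -/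
  uniform_contraction : ∃ η : ℝ, 0 < η ∧ η < 1 ∧ ∃ N : ℕ, ∀ n ≥ N, ∀ (m : ℕ)
    (ω : Word index m (n + 1)), ∀ x ∈ X, ‖fderiv ℝ (wordMap index map m (n + 1) ω) x‖ ≤ η ^ n

/-- `‖Df‖ = sup {|Df(x)| : x ∈ X}`; for a similarity the operator norm is the scaling factor. -/
def derivNorm {d : ℕ} (X : Set (E d)) (f : E d → E d) : ℝ≥0∞ :=
  ⨆ x ∈ X, ‖fderiv ℝ f x‖ₑ

namespace NCIFS

variable {d : ℕ} {X : Set (E d)} (S : NCIFS X)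

/-- The map `φ_ω` of an initial word `ω` of length `n`. -/
def initialMap (n : ℕ) (ω : Word S.index 0 n) : E d → E d :=
  wordMap S.index S.map 0 n ω

/-- The limit set `J = ⋂_{n ≥ 1} ⋃_{|ω| = n} φ_ω(X)`. -/
def limitSet : Set (E d) :=
  ⋂ n : ℕ, ⋃ ω : Word S.index 0 (n + 1), S.initialMap (n + 1) ω '' X

/-- `Z_n(t) = ∑_{|ω| = n} ‖Dφ_ω‖^t`. -/
def Z (n : ℕ) (t : ℝ) : ℝ≥0∞ :=
  ∑' ω : Word S.index 0 n, derivNorm X (S.initialMap n ω) ^ t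

/-- The lower pressure `liminf (1/n) log Z_n(t)`, with values in `[-∞, ∞]`. -/
def lowerPressure (t : ℝ) : EReal :=
  liminf (fun n : ℕ => ENNReal.log (S.Z n t) / (n : EReal)) atTop

/-- The Bowen dimension `sup {t ≥ 0 : lowerPressure t > 0}`, with `sup ∅ = 0`. -/
def bowenDim : ℝ≥0∞ :=
  ⨆ (t : ℝ≥0) (_ : 0 < S.lowerPressure t), (t : ℝ≥0∞)

/-- Bowen's formula: the limit set has Hausdorff dimension equal to the Bowen dimension. -/
def BowenFormula : Prop :=
  dimH S.limitSet = S.bowenDim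

/-- The level sum `∑_k ‖Dφ_k‖^t` over the alphabet of level `n`. -/
def levelSum (n : ℕ) (t : ℝ) : ℝ≥0∞ :=
  ∑' k : S.index n, derivNorm X (S.map n k) ^ t

/-- The part of the level sum coming from the first `R` letters. Letters are natural numbers
starting from `0`, so the letter `k` is the one with label `k + 1 ∈ {1, 2, 3, …}`. -/
def levelSumUpTo (n : ℕ) (R : ℝ) (t : ℝ) : ℝ≥0∞ :=
  ∑' k : {k : S.index n // ((k : ℕ) : ℝ) + 1 ≤ R}, derivNorm X (S.map n k) ^ t

/-- An infinite system: every alphabet is the whole set of natural numbers. -/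
def IsInfinite : Prop :=
  ∀ n, S.index n = univ

/-- The class `𝓜`. Recall that index `n` stands for the level with number `n + 1`. -/
def InClassM : Prop :=
  S.IsInfinite ∧
  ∀ t : ℝ, 0 < t → t < d → ∀ ε : ℝ, 0 < ε →
    ((∀ n, S.levelSum n t = ⊤) ∨ (∀ n, S.levelSum n t < ⊤)) ∧
    ((∀ n, S.levelSum n t < ⊤) →
      Tendsto (fun n : ℕ =>
        S.levelSumUpTo n (Real.exp (ε * ((n : ℝ) + 1))) t / S.levelSum n t) atTop (𝓝 1)) ∧
    ((∀ n, S.levelSum n t = ⊤) →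
      Tendsto (fun n : ℕ =>
        S.levelSumUpTo n (Real.exp (ε * ((n : ℝ) + 1))) t) atTop (𝓝 ⊤))

/-- The class `EV` of evenly varying systems. -/
def EvenlyVarying : Prop :=
  S.IsInfinite ∧
  ∃ (γ : ℕ → ℝ) (c : ℝ), (∀ i, 0 < γ i) ∧ 1 ≤ c ∧
    ∀ (n : ℕ) (i : S.index n),
      ENNReal.ofReal (γ i / c) ≤ derivNorm X (S.map n i) ∧
      derivNorm X (S.map n i) ≤ ENNReal.ofReal (c * γ i)

/-- The class `𝓜₊`. The alphabets are (finite or infinite) initial segments of the natural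
numbers. -/
def InClassMPlus : Prop :=
  (∀ n, IsLowerSet (S.index n)) ∧
  (∀ ε : ℝ, 0 < ε → ∃ δ : ℝ, 0 < δ ∧ ∀ (n : ℕ) (a : S.index n), ∀ x ∈ X, ∀ y ∈ X,
    dist x y < δ → |‖fderiv ℝ (S.map n a) x‖ - ‖fderiv ℝ (S.map n a) y‖| < ε) ∧
  (∀ a : ℕ, ∃ κ : ℝ, 0 < κ ∧ ∀ (n : ℕ) (ha : a ∈ S.index n),
    ENNReal.ofReal κ ≤ derivNorm X (S.map n ⟨a, ha⟩)) ∧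
  ∀ t : ℝ, 0 ≤ t → t ≤ d → ∀ δ : ℝ, 0 < δ → ∃ M : ℕ, 0 < M ∧
    ((∀ n, S.levelSum n t = ⊤) ∨ (∀ n, S.levelSum n t < ⊤)) ∧
    ((∀ n, S.levelSum n t < ⊤) →
      ∀ n, ENNReal.ofReal (1 - δ) * S.levelSum n t ≤ S.levelSumUpTo n M t) ∧
    ((∀ n, S.levelSum n t = ⊤) →
      ∀ n, ENNReal.ofReal (1 / δ) ≤ S.levelSumUpTo n M t)

end NCIFS

end NonAutonomous

end

/-!
The bound `dim J ≤ B` and the bound `B ≤ d` are a covering and a volume argument. For `B ≤ dim J`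
suppose first that the alphabets are finite, of size at most `exp (ε n)`, with lower pressure at `t`
above `ε`. A ball of radius `r` meets only boundedly many images `φ_ω(X)` of scale larger than `r`
and of a given generation, because the interiors of these images are disjoint and each contains a
ball of comparable size. Hence the words of length `k` whose scale drops below `r` with their last
letter, and whose image meets the ball, carry at most a multiple of `#I⁽ᵏ⁾ r^t` of mass; for every
`n ≥ k`, their extensions carry at most a multiple of `(#I⁽ᵏ⁾ / Z_k(t)) r^t` of the total mass of
the words of length `n`. This is summable over `k`, so a cover of `J` by balls of radii `rᵢ` has
`∑ rᵢ^t` bounded below.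

In general one discards letters. By bounded distortion, keeping all but a small proportion of every
level sum keeps almost all of every transfer operator, and costs arbitrarily little pressure; if the
level sums diverge, finitely many letters per level make the pressure as large as desired. The
classes are tailored so that subexponentially growing alphabets suffice for this.
-/

namespace NonAutonomous

open MeasureTheory

section ConformalMap

variable {M M' M'' : Type*} [NormedAddCommGroup M] [NormedSpace ℝ M]
  [NormedAddCommGroup M'] [NormedSpace ℝ M'] [NormedAddCommGroup M''] [NormedSpace ℝ M'']

theorem norm_map_of_isConformalMap {f : M →L[ℝ] M'} (hf : IsConformalMap f) (x : M) :
    ‖f x‖ = ‖f‖ * ‖x‖ := by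
  cases subsingleton_or_nontrivial M
  · simp [Subsingleton.elim x 0]
  · obtain ⟨c, -, li, rfl⟩ := hf
    simp [norm_smul]

theorem norm_comp_of_isConformalMap {g : M' →L[ℝ] M''} {f : M →L[ℝ] M'}
    (hg : IsConformalMap g) (hf : IsConformalMap f) : ‖g.comp f‖ = ‖g‖ * ‖f‖ := by
  cases subsingleton_or_nontrivial M
  · simp [Subsingleton.elim f 0]
  · obtain ⟨x, hx⟩ := exists_ne (0 : M)
    refine mul_right_cancel₀ (norm_ne_zero_iff.2 hx) ?_
    rw [← norm_map_of_isConformalMap (hg.comp hf), ContinuousLinearMap.comp_apply,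
      norm_map_of_isConformalMap hg, norm_map_of_isConformalMap hf, mul_assoc]

theorem surjective_of_isConformalMap [FiniteDimensional ℝ M] {f : M →L[ℝ] M}
    (hf : IsConformalMap f) : Function.Surjective f :=
  (LinearMap.injective_iff_surjective (f := (f : M →ₗ[ℝ] M))).1 hf.injective

theorem abs_det_of_isConformalMap {U : Type*} [NormedAddCommGroup U] [InnerProductSpace ℝ U]
    [FiniteDimensional ℝ U] {f : U →L[ℝ] U} (hf : IsConformalMap f) :
    |f.det| = ‖f‖ ^ Module.finrank ℝ U := by
  cases subsingleton_or_nontrivial U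
  · simp [Subsingleton.elim f 0, ContinuousLinearMap.det]
  · obtain ⟨c, -, li, rfl⟩ := hf
    calc |(c • li.toContinuousLinearMap).det|
        = (c • li.toLinearMap).normDet := (LinearMap.normDet_eq_abs_det _).symm
      _ = ‖c • li.toContinuousLinearMap‖ ^ Module.finrank ℝ U := by
          rw [LinearMap.normDet_smul, li.normDet_eq_one]
          simp [norm_smul]

end ConformalMap

/-! ### Corkscrews in phase spaces -/

section Corkscrew

/-- The interior corkscrew condition at the points of `A`: for every small `s`, the ball of radius
`s` around a point of `A` contains a ball of comparable radius that lies in the interior of `X`.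
It is what the three kinds of phase spaces have in common. -/
def HasCorkscrewsOn {M : Type*} [PseudoMetricSpace M] (X A : Set M) : Prop :=
  ∃ κ > 0, ∃ s₀ > 0, ∀ p ∈ A, ∀ s, 0 < s → s ≤ s₀ →
    ∃ y, Metric.ball y (κ * s) ⊆ interior X ∩ Metric.ball p s

theorem subset_interior_of_isPreconnected {M : Type*} [TopologicalSpace M] {X s : Set M}
    (hs : IsPreconnected s) (hne : (s ∩ interior X).Nonempty) (hf : Disjoint s (frontier X)) :
    s ⊆ interior X := by
  refine hs.subset_of_closure_inter_subset isOpen_interior hne fun x ⟨hx, hxs⟩ => ?_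
  by_contra hxi
  exact hf.le_bot ⟨hxs, closure_mono interior_subset hx, hxi⟩

section Metric

variable {M : Type*} [PseudoMetricSpace M] {X A B : Set M}

theorem HasCorkscrewsOn.mono (hB : HasCorkscrewsOn X B) (h : A ⊆ B) : HasCorkscrewsOn X A := by
  obtain ⟨κ, hκ, s₀, hs₀, H⟩ := hB
  exact ⟨κ, hκ, s₀, hs₀, fun p hp => H p (h hp)⟩

theorem hasCorkscrewsOn_empty : HasCorkscrewsOn X ∅ :=
  ⟨1, one_pos, 1, one_pos, fun _ hp => hp.elim⟩

theorem HasCorkscrewsOn.union (hA : HasCorkscrewsOn X A) (hB : HasCorkscrewsOn X B) :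
    HasCorkscrewsOn X (A ∪ B) := by
  obtain ⟨κ, hκ, s₀, hs₀, HA⟩ := hA
  obtain ⟨κ', hκ', s₀', hs₀', HB⟩ := hB
  refine ⟨min κ κ', lt_min hκ hκ', min s₀ s₀', lt_min hs₀ hs₀', ?_⟩
  rintro p (hp | hp) s hs hss
  · obtain ⟨y, hy⟩ := HA p hp s hs (hss.trans (min_le_left _ _))
    exact ⟨y, (Metric.ball_subset_ball (by gcongr; exact min_le_left _ _)).trans hy⟩
  · obtain ⟨y, hy⟩ := HB p hp s hs (hss.trans (min_le_right _ _))
    exact ⟨y, (Metric.ball_subset_ball (by gcongr; exact min_le_right _ _)).trans hy⟩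

theorem hasCorkscrewsOn_of_locally (hA : IsCompact A)
    (h : ∀ p ∈ A, ∃ U ∈ 𝓝[A] p, HasCorkscrewsOn X U) : HasCorkscrewsOn X A :=
  hA.induction_on hasCorkscrewsOn_empty (fun _ _ hst ht => ht.mono hst)
    (fun _ _ hs ht => hs.union ht) h

end Metric

section Normed

variable {F : Type*} [NormedAddCommGroup F] [NormedSpace ℝ F] {X : Set F}

theorem hasCorkscrewsOn_self_of_frontier (h : HasCorkscrewsOn X (frontier X)) :
    HasCorkscrewsOn X X := by
  obtain ⟨κ, hκ, s₀, hs₀, H⟩ := h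
  refine ⟨min κ 1 / 2, by positivity, s₀, hs₀, fun p hp s hs hss => ?_⟩
  by_cases hfr : ∃ q ∈ frontier X, dist q p < s / 2
  · obtain ⟨q, hq, hqp⟩ := hfr
    obtain ⟨y, hy⟩ := H q hq (s / 2) (by linarith) (by linarith)
    have hκs : min κ 1 / 2 * s ≤ κ * (s / 2) := by nlinarith [min_le_left κ 1]
    refine ⟨y, (Metric.ball_subset_ball hκs).trans (hy.trans ?_)⟩
    exact inter_subset_inter_right _ (Metric.ball_subset_ball' (by linarith))
  · push Not at hfr
    have hdisj : Disjoint (Metric.ball p (s / 2)) (frontier X) :=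
      disjoint_left.2 fun q hq hqf => (hfr q hqf).not_gt hq
    have hpball : p ∈ Metric.ball p (s / 2) := Metric.mem_ball_self (by linarith)
    have hpi : p ∈ interior X := by
      by_contra hpi
      exact disjoint_left.1 hdisj hpball ⟨subset_closure hp, hpi⟩
    have hsub : Metric.ball p (s / 2) ⊆ interior X :=
      subset_interior_of_isPreconnected (convex_ball p _).isPreconnected ⟨p, hpball, hpi⟩ hdisj
    have hκs : min κ 1 / 2 * s ≤ s / 2 := by nlinarith [min_le_right κ 1]
    refine ⟨p, (Metric.ball_subset_ball hκs).trans (subset_inter hsub ?_)⟩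
    exact Metric.ball_subset_ball (by linarith)

theorem hasCorkscrewsOn_of_convex (hX : Convex ℝ X) (hne : (interior X).Nonempty)
    (hb : Bornology.IsBounded X) : HasCorkscrewsOn X X := by
  obtain ⟨x₀, hx₀⟩ := hne
  obtain ⟨ρ, hρ, hball⟩ := Metric.isOpen_iff.1 isOpen_interior x₀ hx₀
  obtain ⟨D, hD, hXD⟩ := hb.subset_closedBall_lt 0 x₀
  refine ⟨ρ / (ρ + D), by positivity, ρ + D, by positivity, fun p hp s hs hsT => ?_⟩
  set lam := s / (ρ + D) with hlam
  have hlam0 : 0 < lam := by positivity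
  have hlam1 : lam ≤ 1 := (div_le_one (by positivity)).2 hsT
  refine ⟨p + lam • (x₀ - p), fun z hz => ?_⟩
  obtain ⟨w, rfl⟩ : ∃ w, z = p + lam • (w - p) :=
    ⟨p + lam⁻¹ • (z - p), by simp [smul_smul, hlam0.ne']⟩
  have hw : dist w x₀ < ρ := by
    have h : dist (p + lam • (w - p)) (p + lam • (x₀ - p)) = lam * dist w x₀ := by
      rw [dist_add_left, dist_smul₀, dist_sub_right, Real.norm_of_nonneg hlam0.le]
    have hρs : ρ / (ρ + D) * s = lam * ρ := div_mul_comm _ _ _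
    rw [Metric.mem_ball, h, hρs] at hz
    exact lt_of_mul_lt_mul_left hz hlam0.le
  constructor
  · have := hX.combo_self_interior_mem_interior hp (hball hw) (sub_nonneg.2 hlam1) hlam0 (by ring)
    convert this using 1
    module
  · have hwp : dist w p < ρ + D := (dist_triangle w x₀ p).trans_lt
      (add_lt_add_of_lt_of_le hw (by rw [dist_comm]; exact hXD hp))
    calc dist (p + lam • (w - p)) p = lam * dist w p := by
          rw [dist_self_add_left, norm_smul, Real.norm_of_nonneg hlam0.le, dist_eq_norm]
      _ < lam * (ρ + D) := by gcongr
      _ = s := by rw [hlam]; field_simp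

theorem exists_cone_le_of_hasStrictFDerivAt {g : F → ℝ} {v : F →L[ℝ] ℝ} {p u : F}
    (hg : HasStrictFDerivAt g v p) (hu : v u = 1) :
    ∃ κ > 0, ∃ R > 0, ∀ x ∈ Metric.ball p R, ∀ y ∈ Metric.ball p R, ∀ σ : ℝ, 0 ≤ σ →
      ‖y - x - σ • u‖ ≤ κ * σ → g x ≤ g y := by
  obtain ⟨κ, hκ, hvκ⟩ : ∃ κ > 0, ‖v‖ * κ ≤ 1 / 2 :=
    ⟨1 / (2 * (‖v‖ + 1)), by positivity, by
      rw [mul_one_div, div_le_div_iff₀ (by positivity) two_pos]; linarith⟩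
  obtain ⟨ε, hε, huε⟩ : ∃ ε > 0, ε * (‖u‖ + κ) ≤ 1 / 2 :=
    ⟨1 / (2 * (‖u‖ + κ)), by positivity, by
      rw [one_div_mul_eq_div, div_le_div_iff₀ (by positivity) two_pos]; linarith⟩
  obtain ⟨W, hW, hgW⟩ := mem_prod_same_iff.1
    (nhds_prod_eq (x := p) (y := p) ▸ hg.isLittleO.def hε)
  obtain ⟨R, hR, hRW⟩ := Metric.mem_nhds_iff.1 hW
  refine ⟨κ, hκ, R, hR, fun x hx y hy σ hσ hxy => ?_⟩
  have hlin : |g y - g x - v (y - x)| ≤ ε * ‖y - x‖ := hgW (mk_mem_prod (hRW hy) (hRW hx))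
  have hnorm : ‖y - x‖ ≤ σ * (‖u‖ + κ) := by
    calc ‖y - x‖ = ‖σ • u + (y - x - σ • u)‖ := by congr 1; abel
      _ ≤ ‖σ • u‖ + ‖y - x - σ • u‖ := norm_add_le _ _
      _ ≤ σ * (‖u‖ + κ) := by rw [norm_smul, Real.norm_of_nonneg hσ]; linarith
  have hv : |v (y - x) - σ| ≤ σ * (1 / 2) := by
    calc |v (y - x) - σ| = ‖v (y - x - σ • u)‖ := by
          rw [map_sub v _ (σ • u), map_smul, hu, smul_eq_mul, mul_one, Real.norm_eq_abs]
      _ ≤ ‖v‖ * (κ * σ) := v.le_opNorm_of_le hxy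
      _ ≤ σ * (1 / 2) := by nlinarith
  have hε' : ε * ‖y - x‖ ≤ σ * (1 / 2) := by nlinarith
  linarith [(abs_le.1 hlin).1, (abs_le.1 hv).1]

theorem ball_inter_subset_interior_of_cone_le {W : Set F} (hW : Convex ℝ W) {g : F → ℝ} {u : F}
    {κ : ℝ} (hmono : ∀ x ∈ W, ∀ y ∈ W, ∀ σ : ℝ, 0 ≤ σ → ‖y - x - σ • u‖ ≤ κ * σ → g x ≤ g y)
    (hfr : ∀ x ∈ frontier X, x ∈ W → g x = 0) {q : F} (hqW : q ∈ W) (hq : q ∈ interior X)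
    (hgq : 0 < g q) {σ : ℝ} (hσ : 0 ≤ σ) :
    Metric.ball (q + σ • u) (κ * σ) ∩ W ⊆ interior X := by
  rintro z ⟨hz, hzW⟩
  have hpos : ∀ y ∈ segment ℝ q z, y ∈ W ∧ 0 < g y := by
    intro y hy
    have hyW := hW.segment_subset hqW hzW hy
    rw [segment_eq_image'] at hy
    obtain ⟨θ, ⟨hθ, -⟩, rfl⟩ := hy
    refine ⟨hyW, hgq.trans_le (hmono q hqW _ hyW (θ * σ) (by positivity) ?_)⟩
    calc ‖q + θ • (z - q) - q - (θ * σ) • u‖ = θ * ‖z - (q + σ • u)‖ := by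
          rw [← norm_smul_of_nonneg hθ]; congr 1; module
      _ ≤ θ * (κ * σ) := by gcongr; exact (mem_ball_iff_norm.1 hz).le
      _ = κ * (θ * σ) := by ring
  refine subset_interior_of_isPreconnected (convex_segment q z).isPreconnected
    ⟨q, left_mem_segment _ _ _, hq⟩ ?_ (right_mem_segment _ _ _)
  exact disjoint_left.2 fun y hy hyf => (hpos y hy).2.ne' (hfr y hyf (hpos y hy).1)

theorem exists_ball_inter_subset_interior_of_cone_le {W : Set F} (hW : Convex ℝ W) {g : F → ℝ}
    {u : F} {κ : ℝ}
    (hmono : ∀ x ∈ W, ∀ y ∈ W, ∀ σ : ℝ, 0 ≤ σ → ‖y - x - σ • u‖ ≤ κ * σ → g x ≤ g y)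
    (hfr : ∀ x ∈ frontier X, x ∈ W → g x = 0) {q : F} (hqW : q ∈ W) (hq : q ∈ interior X)
    (hgq : g q ≠ 0) :
    ∃ u', ‖u'‖ = ‖u‖ ∧ ∀ σ : ℝ, 0 ≤ σ → Metric.ball (q + σ • u') (κ * σ) ∩ W ⊆ interior X := by
  rcases hgq.lt_or_gt with hneg | hpos
  · refine ⟨-u, norm_neg u, fun σ hσ => ?_⟩
    refine ball_inter_subset_interior_of_cone_le (g := -g) hW (fun x hx y hy τ hτ hxy => ?_)
      (fun x hx hxW => neg_eq_zero.2 (hfr x hx hxW)) hqW hq (neg_pos.2 hneg) hσ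
    refine neg_le_neg (hmono y hy x hx τ hτ (le_of_eq_of_le ?_ hxy))
    rw [← norm_neg]
    congr 1
    module
  · exact ⟨u, rfl, fun σ hσ => ball_inter_subset_interior_of_cone_le hW hmono hfr hqW hq hpos hσ⟩

theorem hasCorkscrewsOn_frontier_inter_ball (hX : closure (interior X) = X) {p : F} {U : Set F}
    {g : F → ℝ} {v : F →L[ℝ] ℝ} (hU : U ∈ 𝓝 p) (hg : HasStrictFDerivAt g v p) (hv : v ≠ 0)
    (hfr : frontier X ∩ U = {x ∈ U | g x = 0}) :
    ∃ ρ > 0, HasCorkscrewsOn X (frontier X ∩ Metric.ball p ρ) := by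
  obtain ⟨u, hu⟩ := LinearMap.surjective (f := (v : F →ₗ[ℝ] ℝ)) (by exact_mod_cast hv) 1
  obtain ⟨κ, hκ, R₁, hR₁, hmono⟩ := exists_cone_le_of_hasStrictFDerivAt hg hu
  obtain ⟨R₂, hR₂, hRU⟩ := Metric.mem_nhds_iff.1 hU
  obtain ⟨R, hR, hRR₁, hRR₂⟩ : ∃ R > 0, R ≤ R₁ ∧ R ≤ R₂ :=
    ⟨min R₁ R₂, lt_min hR₁ hR₂, min_le_left _ _, min_le_right _ _⟩
  have hW₁ := Metric.ball_subset_ball (x := p) hRR₁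
  have hW₂ := (Metric.ball_subset_ball (x := p) hRR₂).trans hRU
  set N := 2 * (‖u‖ + κ) with hN
  have hN0 : 0 < N := by positivity
  refine ⟨R / 2, by positivity, κ / N, by positivity, R / 2, by positivity, ?_⟩
  rintro q ⟨hqf, hqp⟩ s hs hsR
  have hqX : q ∈ closure (interior X) := by
    rw [hX, ← (hX ▸ isClosed_closure : IsClosed X).closure_eq]; exact hqf.1
  obtain ⟨q', hq', hqq'⟩ := Metric.mem_closure_iff.1 hqX (s / 2) (by linarith)
  have hball : Metric.ball q s ⊆ Metric.ball p R :=
    Metric.ball_subset_ball' (by linarith [Metric.mem_ball.1 hqp])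
  have hq'W : q' ∈ Metric.ball p R := hball (by rw [Metric.mem_ball']; linarith)
  have hgq' : g q' ≠ 0 := fun h0 => (hfr.ge ⟨hW₂ hq'W, h0⟩).1.2 hq'
  obtain ⟨u', hu', hsub⟩ := exists_ball_inter_subset_interior_of_cone_le (convex_ball p R)
    (fun x hx y hy => hmono x (hW₁ hx) y (hW₁ hy))
    (fun x hx hxW => (hfr.le ⟨hx, hW₂ hxW⟩).2) hq'W hq' hgq'
  have hinc : Metric.ball (q' + (s / N) • u') (κ * (s / N)) ⊆ Metric.ball q s := by
    refine Metric.ball_subset_ball' ?_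
    have hσ : s / N * (‖u‖ + κ) = s / 2 := by rw [hN]; field_simp
    have hdist : dist (q' + (s / N) • u') q' = s / N * ‖u‖ := by
      rw [dist_self_add_left, norm_smul, hu', Real.norm_of_nonneg (div_pos hs hN0).le]
    linarith [dist_triangle (q' + (s / N) • u') q' q, dist_comm q q']
  rw [div_mul_eq_mul_div, ← mul_div_assoc']
  exact ⟨_, subset_inter
    ((subset_inter subset_rfl (hinc.trans hball)).trans (hsub _ (by positivity))) hinc⟩

end Normed

variable {d : ℕ} {X : Set (E d)}

theorem ball_subset_openCone {α : ℝ} (hα0 : 0 < α) (hα : α < Real.pi / 2) {q u : E d}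
    (hu : ‖u‖ = 1) {s l : ℝ} (hs : 0 < s) (hl : s ≤ l) :
    Metric.ball (q + (s / 2) • u) ((1 - Real.cos α) / 8 * s) ⊆
      openCone q u α l ∩ Metric.ball q s := by
  have hc0 : 0 < Real.cos α := Real.cos_pos_of_mem_Ioo ⟨by linarith, hα⟩
  intro z hz
  set w := z - (q + (s / 2) • u) with hw
  have hwn : ‖w‖ < (1 - Real.cos α) / 8 * s := by rw [hw, ← dist_eq_norm]; exact hz
  have hzq : z - q = (s / 2) • u + w := by rw [hw]; abel
  have hup : ‖z - q‖ ≤ s / 2 + ‖w‖ := by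
    rw [hzq]
    refine (norm_add_le _ _).trans ?_
    rw [norm_smul, hu, Real.norm_of_nonneg (by positivity), mul_one]
  have hin : s / 2 - ‖w‖ ≤ inner ℝ (z - q) u := by
    rw [hzq, inner_add_left, real_inner_smul_left, real_inner_self_eq_norm_sq, hu]
    have := neg_le_of_abs_le (abs_real_inner_le_norm w u)
    rw [hu] at this
    linarith
  have hlow : s / 2 - ‖w‖ ≤ ‖z - q‖ := by
    simpa [hu] using hin.trans (real_inner_le_norm _ _)
  have hwsmall : ‖w‖ < s / 8 := by nlinarith
  refine ⟨⟨by linarith, by linarith, ?_⟩, mem_ball_iff_norm.2 (by linarith)⟩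
  have hcos : Real.cos α * ‖z - q‖ ≤ Real.cos α * (s / 2 + ‖w‖) := by gcongr
  nlinarith [Real.cos_le_one α]

theorem HasConeCondition.hasCorkscrewsOn_frontier (hX : HasConeCondition X) :
    HasCorkscrewsOn X (frontier X) := by
  obtain ⟨α, l, hα0, hα, hl, h⟩ := hX
  have hcos : Real.cos α < 1 := by
    simpa using Real.cos_lt_cos_of_nonneg_of_le_pi_div_two le_rfl hα.le hα0
  refine ⟨(1 - Real.cos α) / 8, by linarith, l, hl, fun p hp s hs hsl => ?_⟩
  obtain ⟨u, hu, hcone⟩ := h p hp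
  exact ⟨_, (ball_subset_openCone hα0 hα hu hs hsl).trans (inter_subset_inter_left _ hcone)⟩

theorem HasSmoothBoundary.hasCorkscrewsOn_frontier (hX : HasSmoothBoundary X)
    (hc : IsCompact X) (hcl : closure (interior X) = X) : HasCorkscrewsOn X (frontier X) := by
  refine hasCorkscrewsOn_of_locally (hc.of_isClosed_subset isClosed_frontier
    hc.isClosed.frontier_subset) fun p hp => ?_
  obtain ⟨U, g, hU, hpU, hg, hgp, hfr⟩ := hX p hp
  have hstrict := (hg.contDiffAt (hU.mem_nhds hpU)).hasStrictFDerivAt one_ne_zero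
  obtain ⟨ρ, hρ, h⟩ :=
    hasCorkscrewsOn_frontier_inter_ball hcl (hU.mem_nhds hpU) hstrict hgp hfr
  exact ⟨_, inter_mem_nhdsWithin _ (Metric.ball_mem_nhds p hρ), h⟩

theorem IsPhaseSpace.hasCorkscrewsOn (hX : IsPhaseSpace X) : HasCorkscrewsOn X X := by
  rcases hX.geometry with h | h | h
  · refine hasCorkscrewsOn_of_convex h ?_ hX.isCompact.isBounded
    rw [← closure_nonempty_iff, hX.closure_interior]
    exact hX.nonempty
  · exact hasCorkscrewsOn_self_of_frontier
      (h.hasCorkscrewsOn_frontier hX.isCompact hX.closure_interior)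
  · exact hasCorkscrewsOn_self_of_frontier h.hasCorkscrewsOn_frontier

end Corkscrew

/-! ### Conformal maps with bounded distortion -/

section SingleMap

variable {d : ℕ}

/-- Injective conformal maps on `V` whose scaling factors at two points differ at most by the
factor `K`. All compositions of maps of an NCIFS are of this kind, with the same `K` and `V`. -/
structure IsConformalWithDistortion (K : ℝ≥0) (V : Set (E d)) (f : E d → E d) : Prop where
  injOn : InjOn f V
  conformalAt : ∀ x ∈ V, ConformalAt f x
  enorm_fderiv_le : ∀ x ∈ V, ∀ y ∈ V, ‖fderiv ℝ f x‖ₑ ≤ K * ‖fderiv ℝ f y‖ₑ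

variable {X V : Set (E d)} {K : ℝ≥0} {f : E d → E d}

theorem enorm_fderiv_le_derivNorm {x : E d} (hx : x ∈ X) : ‖fderiv ℝ f x‖ₑ ≤ derivNorm X f :=
  le_iSup₂ (f := fun y (_ : y ∈ X) => ‖fderiv ℝ f y‖ₑ) x hx

theorem exists_convex_cover (hX : IsCompact X) (hV : IsOpen V) (hXV : X ⊆ V) :
    ∃ T : Finset (Set (E d)), X ⊆ ⋃ A ∈ T, A ∧
      ∃ b : ℝ≥0, ∀ A ∈ T, Convex ℝ A ∧ A ⊆ V ∧ Metric.ediam A ≤ b := by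
  classical
  obtain ⟨δ, hδ, hδV⟩ := hX.exists_thickening_subset_open hV hXV
  obtain ⟨P, hPX, hP, hcov⟩ := hX.finite_cover_balls hδ
  refine ⟨hP.toFinset.image fun p => Metric.ball p δ, by simpa using hcov,
    2 * δ.toNNReal, fun A hA => ?_⟩
  obtain ⟨p, hp, rfl⟩ := Finset.mem_image.1 hA
  have hpX : p ∈ X := hPX (by simpa using hp)
  refine ⟨convex_ball p δ, (Metric.ball_subset_thickening hpX δ).trans hδV, ?_⟩
  rw [← Metric.eball_ofReal]
  exact Metric.ediam_eball_le

namespace IsConformalWithDistortion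

variable (hf : IsConformalWithDistortion K V f)
include hf

theorem isConformalMap_fderiv {x : E d} (hx : x ∈ V) : IsConformalMap (fderiv ℝ f x) :=
  conformalAt_iff_isConformalMap_fderiv.1 (hf.conformalAt x hx)

theorem continuousOn : ContinuousOn f V := fun x hx =>
  (hf.conformalAt x hx).differentiableAt.continuousAt.continuousWithinAt

theorem measurableSet_image {A : Set (E d)} (hA : MeasurableSet A) (hAV : A ⊆ V) :
    MeasurableSet (f '' A) :=
  hA.image_of_continuousOn_injOn (hf.continuousOn.mono hAV) (hf.injOn.mono hAV)

theorem derivNorm_le (hXV : X ⊆ V) {y : E d} (hy : y ∈ V) :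
    derivNorm X f ≤ K * ‖fderiv ℝ f y‖ₑ :=
  iSup₂_le fun x hx => hf.enorm_fderiv_le x (hXV hx) y hy

theorem enorm_fderiv_le_mul_derivNorm (hXV : X ⊆ V) (hne : X.Nonempty) {y : E d} (hy : y ∈ V) :
    ‖fderiv ℝ f y‖ₑ ≤ K * derivNorm X f := by
  obtain ⟨x, hx⟩ := hne
  exact (hf.enorm_fderiv_le y hy x (hXV hx)).trans (by gcongr; exact enorm_fderiv_le_derivNorm hx)

theorem derivNorm_ne_top (hXV : X ⊆ V) (hne : X.Nonempty) : derivNorm X f ≠ ⊤ := by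
  obtain ⟨x, hx⟩ := hne
  exact ne_top_of_le_ne_top (ENNReal.mul_ne_top ENNReal.coe_ne_top enorm_ne_top)
    (hf.derivNorm_le hXV (hXV hx))

theorem derivNorm_ne_zero [Nontrivial (E d)] (hXV : X ⊆ V) (hne : X.Nonempty) :
    derivNorm X f ≠ 0 := by
  obtain ⟨x, hx⟩ := hne
  have h : 0 < ‖fderiv ℝ f x‖ₑ :=
    ENNReal.coe_pos.2 (nnnorm_pos.2 (hf.isConformalMap_fderiv (hXV hx)).ne_zero)
  exact (h.trans_le (enorm_fderiv_le_derivNorm hx)).ne'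

theorem derivNorm_pow_mul_volume_le (hXV : X ⊆ V) {A : Set (E d)} (hA : MeasurableSet A)
    (hAV : A ⊆ V) : derivNorm X f ^ d * volume A ≤ (K : ℝ≥0∞) ^ d * volume (f '' A) := by
  have hKd : (K : ℝ≥0∞) ^ d ≠ ⊤ := ENNReal.pow_ne_top ENNReal.coe_ne_top
  rw [← lintegral_abs_det_fderiv_eq_addHaar_image volume hA (fun x hx =>
      (hf.conformalAt x (hAV hx)).differentiableAt.hasFDerivAt.hasFDerivWithinAt)
      (hf.injOn.mono hAV), ← lintegral_const_mul' _ _ hKd, ← setLIntegral_const]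
  refine setLIntegral_mono' hA fun x hx => ?_
  rw [abs_det_of_isConformalMap (hf.isConformalMap_fderiv (hAV hx)), finrank_euclideanSpace_fin,
    ENNReal.ofReal_pow (norm_nonneg _), ofReal_norm, ← mul_pow]
  gcongr
  exact hf.derivNorm_le hXV (hAV hx)

theorem pow_mul_volume_ball_le (hXV : X ⊆ V) {ℓ r : ℝ≥0} (hℓ : (ℓ : ℝ≥0∞) = derivNorm X f)
    (hℓ0 : 0 < ℓ) (hr : 0 < r) {y : E d} {s : ℝ} (hV : Metric.ball y (r / ℓ * s) ⊆ V) :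
    (r : ℝ≥0∞) ^ d * volume (Metric.ball (0 : E d) s) ≤
      (K : ℝ≥0∞) ^ d * volume (f '' Metric.ball y (r / ℓ * s)) := by
  have hvol := hf.derivNorm_pow_mul_volume_le hXV Metric.isOpen_ball.measurableSet hV
  have hscale : (ℓ : ℝ≥0∞) ^ d * ENNReal.ofReal ((r / ℓ : ℝ) ^ d) = (r : ℝ≥0∞) ^ d := by
    rw [← NNReal.coe_div, ENNReal.ofReal_pow (NNReal.coe_nonneg _), ENNReal.ofReal_coe_nnreal,
      ← mul_pow, ← ENNReal.coe_mul, mul_div_cancel₀ _ hℓ0.ne']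
  rwa [Measure.addHaar_ball_mul_of_pos _ _ (by positivity), finrank_euclideanSpace_fin, ← hℓ,
    ← mul_assoc, hscale] at hvol

theorem lipschitzOnWith (hXV : X ⊆ V) (hne : X.Nonempty) {C : Set (E d)} (hC : Convex ℝ C)
    (hCV : C ⊆ V) : LipschitzOnWith (K * (derivNorm X f).toNNReal) f C := by
  refine hC.lipschitzOnWith_of_nnnorm_fderiv_le (𝕜 := ℝ)
    (fun x hx => (hf.conformalAt x (hCV hx)).differentiableAt) fun x hx => ?_
  rw [← ENNReal.coe_le_coe, ENNReal.coe_mul, ENNReal.coe_toNNReal (hf.derivNorm_ne_top hXV hne)]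
  exact hf.enorm_fderiv_le_mul_derivNorm hXV hne (hCV hx)

theorem ediam_image_le (hXV : X ⊆ V) (hne : X.Nonempty) {C : Set (E d)} (hC : Convex ℝ C)
    (hCV : C ⊆ V) : Metric.ediam (f '' C) ≤ K * derivNorm X f * Metric.ediam C := by
  rw [← ENNReal.coe_toNNReal (hf.derivNorm_ne_top hXV hne), ← ENNReal.coe_mul,
    Metric.ediam_image_le_iff]
  exact fun x hx y hy => (hf.lipschitzOnWith hXV hne hC hCV).edist_le_mul_of_le hx hy
    (Metric.edist_le_ediam_of_mem hx hy)

end IsConformalWithDistortion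

theorem exists_packing_constants (hX : IsPhaseSpace X) (hV : IsOpen V) (hXV : X ⊆ V) (K : ℝ≥0) :
    ∃ R : ℝ≥0, ∃ v : ℝ≥0∞, v ≠ 0 ∧ ∀ f, IsConformalWithDistortion K V f → ∀ (x : E d) (r : ℝ≥0),
      0 < r → r < derivNorm X f → (f '' X ∩ Metric.ball x r).Nonempty →
        ∃ U ⊆ interior X, IsOpen U ∧ f '' U ⊆ Metric.ball x (R * r) ∧
          (r : ℝ≥0∞) ^ d * v ≤ volume (f '' U) := by
  obtain ⟨κ, hκ, s₀, hs₀, hcork⟩ := hX.hasCorkscrewsOn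
  obtain ⟨δ, hδ, hδV⟩ := hX.isCompact.exists_thickening_subset_open hV hXV
  set s₁ := min s₀ δ
  have hs₁ : 0 < s₁ := lt_min hs₀ hδ
  have hv : volume (Metric.ball (0 : E d) (κ * s₁)) ≠ 0 :=
    (Metric.measure_ball_pos _ _ (by positivity)).ne'
  refine ⟨1 + K * s₁.toNNReal, volume (Metric.ball (0 : E d) (κ * s₁)) / (K : ℝ≥0∞) ^ d,
    ENNReal.div_ne_zero.2 ⟨hv, ENNReal.pow_ne_top ENNReal.coe_ne_top⟩, fun f hf x r hr hrf => ?_⟩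
  rintro ⟨_, ⟨p, hp, rfl⟩, hpx⟩
  obtain ⟨ℓ, hℓ⟩ : ∃ ℓ : ℝ≥0, (ℓ : ℝ≥0∞) = derivNorm X f :=
    ⟨_, ENNReal.coe_toNNReal (hf.derivNorm_ne_top hXV hX.nonempty)⟩
  rw [← hℓ, ENNReal.coe_lt_coe] at hrf
  have hℓ0 : 0 < ℓ := hr.trans hrf
  have hrℓ : (r / ℓ : ℝ) ≤ 1 := div_le_one_of_le₀ hrf.le ℓ.2
  have hsmall : r / ℓ * s₁ ≤ s₁ := mul_le_of_le_one_left hs₁.le hrℓ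
  obtain ⟨y, hy⟩ := hcork p hp (r / ℓ * s₁) (by positivity) (hsmall.trans (min_le_left _ _))
  rw [mul_left_comm] at hy
  have hballV : Metric.ball p (r / ℓ * s₁) ⊆ V :=
    (Metric.ball_subset_ball (hsmall.trans (min_le_right _ _))).trans
      ((Metric.ball_subset_thickening hp δ).trans hδV)
  refine ⟨_, hy.trans inter_subset_left, Metric.isOpen_ball, ?_, ?_⟩
  · rintro _ ⟨z, hz, rfl⟩
    have hlip := (hf.lipschitzOnWith hXV hX.nonempty (convex_ball p _) hballV).dist_le_mul z
      (hy hz).2 p (Metric.mem_ball_self (by positivity))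
    rw [← hℓ, ENNReal.toNNReal_coe, NNReal.coe_mul] at hlip
    calc dist (f z) x ≤ dist (f z) (f p) + dist (f p) x := dist_triangle _ _ _
      _ < K * ℓ * (r / ℓ * s₁) + r := by
          refine add_lt_add_of_le_of_lt (hlip.trans ?_) hpx
          gcongr
          exact (hy hz).2.le
      _ = (1 + K * s₁.toNNReal : ℝ≥0) * r := by
          push_cast [Real.coe_toNNReal _ hs₁.le]; field_simp; ring
  · rw [← mul_div_assoc]
    exact ENNReal.div_le_of_le_mul' (hf.pow_mul_volume_ball_le hXV hℓ hℓ0 hr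
      ((hy.trans inter_subset_left).trans (interior_subset.trans hXV)))

end SingleMap

/-! ### Words, subsystems and distortion constants -/

section Words

variable {I I' : ℕ → Set ℕ} {m n : ℕ}

/-- The word without its last letter. -/
def Word.init (ω : Word I m (n + 1)) : Word I m n := fun j => ω j.castSucc

/-- The last letter of a nonempty word. -/
def Word.last (ω : Word I m (n + 1)) : I (m + n) := ω (Fin.last n)

/-- A nonempty word is its last letter together with its initial segment. -/
def Word.snocEquiv (I : ℕ → Set ℕ) (m n : ℕ) : I (m + n) × Word I m n ≃ Word I m (n + 1) :=
  Fin.snocEquiv fun j : Fin (n + 1) => (I (m + j) : Type)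

/-- A word over an alphabet contained in a larger one, read as a word over the larger alphabet. -/
def Word.inclusion (h : ∀ n, I n ⊆ I' n) (ω : Word I m n) : Word I' m n :=
  fun j => Set.inclusion (h _) (ω j)

@[simp] theorem Word.init_snocEquiv (p : I (m + n) × Word I m n) :
    (Word.snocEquiv I m n p).init = p.2 :=
  congrArg Prod.snd ((Word.snocEquiv I m n).symm_apply_apply p)

@[simp] theorem Word.last_snocEquiv (p : I (m + n) × Word I m n) :
    (Word.snocEquiv I m n p).last = p.1 :=
  congrArg Prod.fst ((Word.snocEquiv I m n).symm_apply_apply p)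

theorem Word.ext_init_last {ω ω' : Word I m (n + 1)} (hinit : ω.init = ω'.init)
    (hlast : ω.last = ω'.last) : ω = ω' :=
  (Word.snocEquiv I m n).symm.injective (Prod.ext hlast hinit)

variable {d : ℕ} {φ : (n : ℕ) → I n → E d → E d}

theorem wordMap_succ (ω : Word I m (n + 1)) :
    wordMap I φ m (n + 1) ω = wordMap I φ m n ω.init ∘ φ (m + n) ω.last := rfl

theorem wordMap_inclusion (h : ∀ n, I' n ⊆ I n) (ω : Word I' m n) :
    wordMap I' (fun n a => φ n (Set.inclusion (h n) a)) m n ω =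
      wordMap I φ m n (ω.inclusion h) := by
  induction n with
  | zero => rfl
  | succ n ih => rw [wordMap_succ, wordMap_succ, ih]; rfl

theorem mapsTo_wordMap {A : Set (E d)} (h : ∀ n a, MapsTo (φ n a) A A) (ω : Word I m n) :
    MapsTo (wordMap I φ m n ω) A A := by
  induction n with
  | zero => exact mapsTo_id A
  | succ n ih => exact (ih ω.init).comp (h _ _)

theorem injOn_wordMap {A : Set (E d)} (hmaps : ∀ n a, MapsTo (φ n a) A A)
    (hinj : ∀ n a, InjOn (φ n a) A) (ω : Word I m n) : InjOn (wordMap I φ m n ω) A := by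
  induction n with
  | zero => exact injOn_id A
  | succ n ih => exact (ih ω.init).comp (hinj _ _) (hmaps _ _)

theorem conformalAt_wordMap {A : Set (E d)} (hmaps : ∀ n a, MapsTo (φ n a) A A)
    (hconf : ∀ n a, ∀ x ∈ A, ConformalAt (φ n a) x) (ω : Word I m n) {x : E d} (hx : x ∈ A) :
    ConformalAt (wordMap I φ m n ω) x := by
  induction n generalizing x with
  | zero => exact conformalAt_id x
  | succ n ih => exact (ih ω.init (hmaps _ _ hx)).comp x (hconf _ _ x hx)

theorem tsum_inclusion_inter (A F : Set ℕ) (G : A → ℝ≥0∞) :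
    ∑' a : ↥(A ∩ F), G (inclusion inter_subset_left a) = ∑' a : {a : A | (a : ℕ) ∈ F}, G a :=
  ((Equiv.subtypeSubtypeEquivSubtypeInter (· ∈ A) (· ∈ F)).tsum_eq _).symm

theorem tsum_inclusion_add_tsum_inclusion_compl (A F : Set ℕ) (G : A → ℝ≥0∞) :
    ∑' a : ↥(A ∩ F), G (inclusion inter_subset_left a) +
      ∑' a : ↥(A ∩ Fᶜ), G (inclusion inter_subset_left a) = ∑' a, G a := by
  rw [tsum_inclusion_inter, tsum_inclusion_inter]
  exact ENNReal.summable.tsum_add_tsum_compl ENNReal.summable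

end Words

namespace NCIFS

variable {d : ℕ} {X : Set (E d)} {S : NCIFS X} {K : ℝ≥0}

/-- The subsystem of `S` that at each level `n` only uses the letters in `F n`. -/
noncomputable def restrict (S : NCIFS X) (F : ℕ → Set ℕ) : NCIFS X where
  index n := S.index n ∩ F n
  map n a := S.map n (inclusion inter_subset_left a)
  V := S.V
  isOpen_V := S.isOpen_V
  isConnected_V := S.isConnected_V
  subset_V := S.subset_V
  mapsTo_X _ _ := S.mapsTo_X _ _
  open_set_condition n _ _ h :=
    S.open_set_condition n _ _ ((inclusion_injective inter_subset_left).ne h)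
  mapsTo_V _ _ := S.mapsTo_V _ _
  injOn_V _ _ := S.injOn_V _ _
  contDiffOn_V _ _ := S.contDiffOn_V _ _
  conformalAt_V _ _ := S.conformalAt_V _ _
  bounded_distortion := by
    obtain ⟨K, hK, h⟩ := S.bounded_distortion
    refine ⟨K, hK, fun m n ω => ?_⟩
    rw [wordMap_inclusion]
    exact h m n _
  uniform_contraction := by
    obtain ⟨η, h0, h1, N, h⟩ := S.uniform_contraction
    refine ⟨η, h0, h1, N, fun n hn m ω => ?_⟩
    rw [wordMap_inclusion]
    exact h n hn m _

theorem wordMap_restrict (F : ℕ → Set ℕ) {m n : ℕ} (ω : Word (S.restrict F).index m n) :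
    wordMap (S.restrict F).index (S.restrict F).map m n ω =
      wordMap S.index S.map m n (ω.inclusion fun _ => inter_subset_left) :=
  wordMap_inclusion (φ := S.map) (fun _ => inter_subset_left) ω

theorem limitSet_restrict_subset (F : ℕ → Set ℕ) : (S.restrict F).limitSet ⊆ S.limitSet := by
  refine iInter_mono fun n => iUnion_subset fun ω => ?_
  rw [initialMap, wordMap_restrict]
  exact subset_iUnion_of_subset _ Subset.rfl

theorem levelSum_restrict_add_levelSum_restrict_compl (F : ℕ → Set ℕ) (n : ℕ) (t : ℝ) :
    (S.restrict F).levelSum n t + (S.restrict fun n => (F n)ᶜ).levelSum n t = S.levelSum n t :=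
  tsum_inclusion_add_tsum_inclusion_compl (S.index n) (F n) fun a => derivNorm X (S.map n a) ^ t

theorem levelSumUpTo_eq_levelSum_restrict (n : ℕ) (R t : ℝ) :
    S.levelSumUpTo n R t = (S.restrict fun _ => {k | (k : ℝ) + 1 ≤ R}).levelSum n t :=
  (tsum_inclusion_inter _ {k | (k : ℝ) + 1 ≤ R} fun a => derivNorm X (S.map n a) ^ t).symm

variable (S) in
/-- `K` is a distortion constant for all compositions of maps of `S` along words. -/
structure IsDistortion (K : ℝ≥0) : Prop where
  one_le : 1 ≤ K
  word : ∀ m n (ω : Word S.index m n),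
    IsConformalWithDistortion K S.V (wordMap S.index S.map m n ω)

theorem exists_isDistortion (S : NCIFS X) : ∃ K, S.IsDistortion K := by
  obtain ⟨K, hK1, hK⟩ := S.bounded_distortion
  refine ⟨K.toNNReal, by simpa using hK1, fun m n ω => ⟨injOn_wordMap S.mapsTo_V S.injOn_V ω,
    fun _ => conformalAt_wordMap S.mapsTo_V S.conformalAt_V ω, fun x hx y hy => ?_⟩⟩
  rw [← ofReal_norm, ← ofReal_norm, ← ENNReal.ofReal, ← ENNReal.ofReal_mul (by linarith)]
  exact ENNReal.ofReal_le_ofReal (hK m n ω x hx y hy)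

theorem IsDistortion.initialMap (hK : S.IsDistortion K) (n : ℕ) (ω : Word S.index 0 n) :
    IsConformalWithDistortion K S.V (S.initialMap n ω) :=
  hK.word 0 n ω

theorem IsDistortion.map (hK : S.IsDistortion K) (n : ℕ) (a : S.index n) :
    IsConformalWithDistortion K S.V (S.map n a) :=
  hK.word n 1 fun j => ⟨a, by rw [Subsingleton.elim j 0]; exact a.2⟩

theorem IsDistortion.restrict (hK : S.IsDistortion K) (F : ℕ → Set ℕ) :
    (S.restrict F).IsDistortion K where
  one_le := hK.one_le
  word m n ω := by
    rw [wordMap_restrict]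
    exact hK.word m n _

theorem initialMap_succ (n : ℕ) (ω : Word S.index 0 (n + 1)) :
    S.initialMap (n + 1) ω = S.initialMap n ω.init ∘ S.map (0 + n) ω.last := rfl

theorem image_initialMap_subset (n : ℕ) (ω : Word S.index 0 n) : S.initialMap n ω '' X ⊆ X :=
  (mapsTo_wordMap S.mapsTo_X ω).image_subset

theorem image_map_interior_subset (n : ℕ) (a : S.index n) :
    S.map n a '' interior X ⊆ interior X := by
  rintro _ ⟨x, hx, rfl⟩
  have hxV : x ∈ S.V := S.subset_V (interior_subset hx)
  have hstrict : HasStrictFDerivAt (S.map n a) (fderiv ℝ (S.map n a) x) x :=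
    ((S.contDiffOn_V n a).contDiffAt (S.isOpen_V.mem_nhds hxV)).hasStrictFDerivAt one_ne_zero
  have hrange : (fderiv ℝ (S.map n a) x).range = ⊤ :=
    LinearMap.range_eq_top.2 (surjective_of_isConformalMap
      (conformalAt_iff_isConformalMap_fderiv.1 (S.conformalAt_V n a x hxV)))
  rw [mem_interior_iff_mem_nhds, ← hstrict.map_nhds_eq_of_surj hrange]
  exact mem_map.2 (mem_of_superset (mem_interior_iff_mem_nhds.1 hx) (S.mapsTo_X n a))

theorem pairwise_disjoint_image_initialMap (S : NCIFS X) (n : ℕ) :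
    Pairwise fun ω ω' : Word S.index 0 n =>
      Disjoint (S.initialMap n ω '' interior X) (S.initialMap n ω' '' interior X) := by
  induction n with
  | zero => exact fun ω ω' h => (h (Subsingleton.elim _ _)).elim
  | succ n ih =>
    intro ω ω' h
    rw [initialMap_succ, initialMap_succ, image_comp, image_comp]
    by_cases hinit : ω.init = ω'.init
    · have hlast : ω.last ≠ ω'.last := fun hlast => h (Word.ext_init_last hinit hlast)
      rw [hinit]
      refine (S.open_set_condition (0 + n) _ _ hlast).image (u := S.V)
        (injOn_wordMap S.mapsTo_V S.injOn_V ω'.init) ?_ ?_ <;>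
      exact (image_map_interior_subset _ _).trans (interior_subset.trans S.subset_V)
    · exact (ih hinit).mono (image_mono (image_map_interior_subset _ _))
        (image_mono (image_map_interior_subset _ _))

theorem exists_derivNorm_initialMap_le (S : NCIFS X) : ∃ η : ℝ≥0, 0 < η ∧ η < 1 ∧
    ∀ᶠ n : ℕ in atTop, ∀ ω : Word S.index 0 (n + 1),
      derivNorm X (S.initialMap (n + 1) ω) ≤ (η : ℝ≥0∞) ^ n := by
  obtain ⟨η, h0, h1, N, h⟩ := S.uniform_contraction
  lift η to ℝ≥0 using h0.le
  refine ⟨η, h0, h1, eventually_atTop.2 ⟨N, fun n hn ω => iSup₂_le fun x hx => ?_⟩⟩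
  exact_mod_cast h n hn 0 ω x hx

end NCIFS

/-! ### The upper bound -/

theorem hausdorffMeasure_le_of_frequently {Y : Type*} [EMetricSpace Y] [MeasurableSpace Y]
    [BorelSpace Y] {s : Set Y} {t : ℝ} {C : ℝ≥0∞} {r : ℕ → ℝ≥0∞} (hr : Tendsto r atTop (𝓝 0))
    {ι : ℕ → Type*} [∀ n, Countable (ι n)] {piece : (n : ℕ) → ι n → Set Y}
    (hdiam : ∀ᶠ n in atTop, ∀ i, Metric.ediam (piece n i) ≤ r n)
    (hcover : ∀ n, s ⊆ ⋃ i, piece n i)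
    (hsum : ∃ᶠ n in atTop, ∑' i, Metric.ediam (piece n i) ^ t ≤ C) : μH[t] s ≤ C := by
  set l := atTop ⊓ 𝓟 {n | ∑' i, Metric.ediam (piece n i) ^ t ≤ C}
  have : l.NeBot := frequently_iff_neBot.1 hsum
  have hC : ∀ᶠ n in l, ∑' i, Metric.ediam (piece n i) ^ t ≤ C :=
    mem_inf_of_right (mem_principal_self _)
  exact (Measure.hausdorffMeasure_le_liminf_tsum t s r (hr.mono_left inf_le_left) piece
    (hdiam.filter_mono inf_le_left) (Eventually.of_forall hcover)).trans
    (liminf_le_of_frequently_le' hC.frequently)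

namespace NCIFS

variable {d : ℕ} {X : Set (E d)} {S : NCIFS X} {K : ℝ≥0}

/-- The words of length `n` whose map has scale larger than `r` and whose image of `X` meets the
ball of radius `r` around `c`. -/
def largeWords (S : NCIFS X) (c : E d) (r : ℝ≥0) (n : ℕ) : Set (Word S.index 0 n) :=
  {ω | r < derivNorm X (S.initialMap n ω) ∧
    (S.initialMap n ω '' X ∩ Metric.ball c r).Nonempty}

theorem exists_encard_largeWords_le (S : NCIFS X) (hX : IsPhaseSpace X) :
    ∃ N₀ : ℝ≥0, ∀ (n : ℕ) (c : E d) (r : ℝ≥0), 0 < r →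
      ((S.largeWords c r n).encard : ℝ≥0∞) ≤ N₀ := by
  obtain ⟨K, hK⟩ := S.exists_isDistortion
  obtain ⟨R, v, hv, hpack⟩ := exists_packing_constants hX S.isOpen_V S.subset_V K
  have hball : volume (Metric.ball (0 : E d) R) ≠ ⊤ := measure_ball_lt_top.ne
  refine ⟨(volume (Metric.ball (0 : E d) R) / v).toNNReal, fun n c r hr => ?_⟩
  rw [ENNReal.coe_toNNReal (ENNReal.div_ne_top hball hv),
    ENNReal.le_div_iff_mul_le (Or.inl hv) (Or.inr hball)]
  choose U hUX hU hUc hvol using fun ω : S.largeWords c r n =>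
    hpack _ (hK.initialMap n ω) c r hr ω.2.1 ω.2.2
  have hmeas : ∀ ω : S.largeWords c r n, MeasurableSet (S.initialMap n ω '' U ω) := fun ω =>
    (hK.initialMap n ω).measurableSet_image (hU ω).measurableSet
      ((hUX ω).trans (interior_subset.trans S.subset_V))
  have hdisj : Pairwise (Function.onFun Disjoint fun ω : S.largeWords c r n =>
      S.initialMap n ω '' U ω) := fun ω ω' hne =>
    (S.pairwise_disjoint_image_initialMap n (Subtype.coe_injective.ne hne)).mono
      (image_mono (hUX ω)) (image_mono (hUX ω'))
  rw [← ENNReal.mul_le_mul_iff_right (a := (r : ℝ≥0∞) ^ d)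
    (pow_ne_zero _ (ENNReal.coe_ne_zero.2 hr.ne')) (ENNReal.pow_ne_top ENNReal.coe_ne_top)]
  calc (r : ℝ≥0∞) ^ d * ((S.largeWords c r n).encard * v)
      = ∑' _ : S.largeWords c r n, (r : ℝ≥0∞) ^ d * v := by
        rw [ENNReal.tsum_set_const, mul_left_comm]
    _ ≤ ∑' ω : S.largeWords c r n, volume (S.initialMap n ω '' U ω) := ENNReal.tsum_le_tsum hvol
    _ = volume (⋃ ω : S.largeWords c r n, S.initialMap n ω '' U ω) :=
        (measure_iUnion hdisj hmeas).symm
    _ ≤ volume (Metric.ball c (r * R)) := measure_mono (iUnion_subset fun ω =>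
        (hUc ω).trans_eq (by rw [mul_comm]))
    _ = (r : ℝ≥0∞) ^ d * volume (Metric.ball (0 : E d) R) := by
        rw [Measure.addHaar_ball_mul_of_pos _ _ (NNReal.coe_pos.2 hr), finrank_euclideanSpace_fin,
          ENNReal.ofReal_pow r.coe_nonneg, ENNReal.ofReal_coe_nnreal]

theorem exists_Z_dim_le (S : NCIFS X) (hX : IsPhaseSpace X) : ∃ C : ℝ≥0, ∀ n, S.Z n d ≤ C := by
  obtain ⟨K, hK⟩ := S.exists_isDistortion
  have hvol : volume (interior X) ≠ 0 := by
    refine (isOpen_interior.measure_pos volume ?_).ne'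
    rw [← closure_nonempty_iff, hX.closure_interior]
    exact hX.nonempty
  have hvolX : (K : ℝ≥0∞) ^ d * volume X ≠ ⊤ :=
    ENNReal.mul_ne_top (ENNReal.pow_ne_top ENNReal.coe_ne_top) hX.isCompact.measure_lt_top.ne
  have hint : interior X ⊆ S.V := interior_subset.trans S.subset_V
  refine ⟨((K : ℝ≥0∞) ^ d * volume X / volume (interior X)).toNNReal, fun n => ?_⟩
  rw [ENNReal.coe_toNNReal (ENNReal.div_ne_top hvolX hvol),
    ENNReal.le_div_iff_mul_le (Or.inl hvol) (Or.inr hvolX), Z, ← ENNReal.tsum_mul_right]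
  calc _ ≤ ∑' ω : Word S.index 0 n, (K : ℝ≥0∞) ^ d * volume (S.initialMap n ω '' interior X) := by
        refine ENNReal.tsum_le_tsum fun ω => ?_
        rw [ENNReal.rpow_natCast]
        exact (hK.initialMap n ω).derivNorm_pow_mul_volume_le S.subset_V
          isOpen_interior.measurableSet hint
    _ = (K : ℝ≥0∞) ^ d * volume (⋃ ω, S.initialMap n ω '' interior X) := by
        rw [ENNReal.tsum_mul_left, measure_iUnion (S.pairwise_disjoint_image_initialMap n) fun ω =>
          (hK.initialMap n ω).measurableSet_image isOpen_interior.measurableSet hint]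
    _ ≤ (K : ℝ≥0∞) ^ d * volume X := by
        gcongr
        exact iUnion_subset fun ω =>
          (image_mono interior_subset).trans (image_initialMap_subset n ω)

theorem lt_lowerPressure_iff {b t : ℝ} : (b : EReal) < S.lowerPressure t ↔
    ∃ a > b, ∀ᶠ n : ℕ in atTop, ENNReal.ofReal (Real.exp (a * n)) ≤ S.Z n t := by
  have hexp : ∀ (a : ℝ) (n : ℕ), 0 < n → (ENNReal.ofReal (Real.exp (a * n)) ≤ S.Z n t ↔
      (a : EReal) ≤ ENNReal.log (S.Z n t) / (n : EReal)) := fun a n hn => by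
    rw [EReal.le_div_iff_mul_le (by exact_mod_cast hn) (EReal.natCast_ne_top n),
      ← EReal.exp_coe, ← ENNReal.exp_log (S.Z n t), EReal.exp_le_exp_iff, EReal.log_exp]
    push_cast
    rfl
  constructor
  · intro h
    obtain ⟨a, hba, ha⟩ := EReal.lt_iff_exists_real_btwn.1 h
    refine ⟨a, by exact_mod_cast hba, ?_⟩
    filter_upwards [eventually_lt_of_lt_liminf ha, eventually_gt_atTop 0] with n hn hn0
    exact (hexp a n hn0).2 hn.le
  · rintro ⟨a, hba, ha⟩
    refine lt_of_lt_of_le (b := (a : EReal)) (by exact_mod_cast hba) ?_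
    refine le_liminf_of_le (by isBoundedDefault) ?_
    filter_upwards [ha, eventually_gt_atTop 0] with n hn hn0
    exact (hexp a n hn0).1 hn

theorem Z_le_rpow_mul_Z {n : ℕ} {b : ℝ≥0∞} (hb : ∀ ω, derivNorm X (S.initialMap n ω) ≤ b)
    {s t : ℝ} (hs : 0 ≤ s) (hst : s ≤ t) : S.Z n t ≤ b ^ (t - s) * S.Z n s := by
  rw [Z, Z, ← ENNReal.tsum_mul_left]
  refine ENNReal.tsum_le_tsum fun ω => ?_
  have hts : 0 ≤ t - s := sub_nonneg.2 hst
  calc derivNorm X (S.initialMap n ω) ^ t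
      = derivNorm X (S.initialMap n ω) ^ (t - s) * derivNorm X (S.initialMap n ω) ^ s := by
        rw [← ENNReal.rpow_add_of_nonneg _ _ hts hs, sub_add_cancel]
    _ ≤ _ := by gcongr; exact hb ω

theorem lt_of_lowerPressure_pos (hX : IsPhaseSpace X) {t : ℝ} (ht : 0 < S.lowerPressure t) :
    t < d := by
  by_contra! hdt
  obtain ⟨a, ha0, ha⟩ := lt_lowerPressure_iff.1 (EReal.coe_zero ▸ ht)
  obtain ⟨C, hC⟩ := S.exists_Z_dim_le hX
  obtain ⟨η, -, hη1, hη⟩ := S.exists_derivNorm_initialMap_le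
  have hlim : Tendsto (fun n : ℕ => Real.exp (a * (n + 1 : ℕ))) atTop atTop :=
    Real.tendsto_exp_atTop.comp
      ((tendsto_natCast_atTop_atTop.comp (tendsto_add_atTop_nat 1)).const_mul_atTop ha0)
  obtain ⟨n, hn, hηn, hCn⟩ := (((tendsto_add_atTop_nat 1).eventually ha).and
    (hη.and (hlim.eventually_gt_atTop (C : ℝ)))).exists
  refine hCn.not_ge ((ENNReal.ofReal_le_ofReal_iff C.coe_nonneg).1 ?_)
  calc ENNReal.ofReal (Real.exp (a * (n + 1 : ℕ))) ≤ S.Z (n + 1) t := hn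
    _ ≤ 1 ^ (t - d) * S.Z (n + 1) d := Z_le_rpow_mul_Z (fun ω => (hηn ω).trans
        (pow_le_one₀ zero_le (by exact_mod_cast hη1.le))) d.cast_nonneg hdt
    _ = S.Z (n + 1) d := by rw [ENNReal.one_rpow, one_mul]
    _ ≤ ENNReal.ofReal C := by rw [ENNReal.ofReal_coe_nnreal]; exact hC _

theorem hausdorffMeasure_limitSet_ne_top (hX : IsPhaseSpace X) {t : ℝ≥0} {C : ℝ≥0∞} (hC : C ≠ ⊤)
    (h : ∃ᶠ n in atTop, S.Z (n + 1) t ≤ C) : μH[t] S.limitSet ≠ ⊤ := by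
  obtain ⟨K, hK⟩ := S.exists_isDistortion
  obtain ⟨T, hTX, b, hT⟩ := exists_convex_cover hX.isCompact S.isOpen_V S.subset_V
  obtain ⟨η, -, hη1, hη⟩ := S.exists_derivNorm_initialMap_le
  let piece (n : ℕ) (q : Word S.index 0 (n + 1) × T) : Set (E d) := S.initialMap (n + 1) q.1 '' q.2
  have hdiam : ∀ n q, Metric.ediam (piece n q) ≤ K * b * derivNorm X (S.initialMap (n + 1) q.1) :=
    fun n q => ((hK.initialMap _ q.1).ediam_image_le S.subset_V hX.nonempty (hT _ q.2.2).1
      (hT _ q.2.2).2.1).trans (by rw [mul_right_comm]; gcongr; exact (hT _ q.2.2).2.2)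
  have hradius : Tendsto (fun n => (K * b * η ^ n : ℝ≥0∞)) atTop (𝓝 0) := by
    have := ENNReal.Tendsto.const_mul (a := (K * b : ℝ≥0∞))
      (ENNReal.tendsto_pow_atTop_nhds_zero_of_lt_one (r := η) (by exact_mod_cast hη1))
      (Or.inr (ENNReal.mul_ne_top ENNReal.coe_ne_top ENNReal.coe_ne_top))
    rwa [mul_zero] at this
  have hsum : ∀ n, ∑' q, Metric.ediam (piece n q) ^ (t : ℝ) ≤
      (K * b : ℝ≥0∞) ^ (t : ℝ) * S.Z (n + 1) t * T.card := fun n => calc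
    _ ≤ ∑' q : Word S.index 0 (n + 1) × T, (K * b : ℝ≥0∞) ^ (t : ℝ) *
          derivNorm X (S.initialMap (n + 1) q.1) ^ (t : ℝ) := ENNReal.tsum_le_tsum fun q => by
        rw [← ENNReal.mul_rpow_of_nonneg _ _ t.coe_nonneg]
        exact ENNReal.rpow_le_rpow (hdiam n q) t.coe_nonneg
    _ = _ := by
        rw [ENNReal.tsum_mul_left, ENNReal.tsum_prod', mul_assoc, Z, ← ENNReal.tsum_mul_right]
        simp [mul_comm]
  refine ne_top_of_le_ne_top (ENNReal.mul_ne_top (ENNReal.mul_ne_top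
    (ENNReal.rpow_ne_top_of_nonneg t.coe_nonneg (ENNReal.mul_ne_top ENNReal.coe_ne_top
      ENNReal.coe_ne_top)) hC) (ENNReal.natCast_ne_top T.card))
    (hausdorffMeasure_le_of_frequently hradius (piece := piece) ?_ (fun n x hx => ?_)
      (h.mono fun n hn => (hsum n).trans (by gcongr)))
  · exact hη.mono fun n hn q => (hdiam n q).trans (by gcongr; exact hn q.1)
  · obtain ⟨ω, y, hy, rfl⟩ := mem_iUnion.1 (mem_iInter.1 hx n)
    obtain ⟨A, hA, hyA⟩ := mem_iUnion₂.1 (hTX hy)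
    exact mem_iUnion.2 ⟨(ω, ⟨A, hA⟩), mem_image_of_mem _ hyA⟩

theorem exists_frequently_Z_le {s t : ℝ} (hs : 0 ≤ s) (hst : s < t)
    (hP : ¬ 0 < S.lowerPressure s) :
    ∃ C : ℝ≥0∞, C ≠ ⊤ ∧ ∃ᶠ n : ℕ in atTop, S.Z (n + 1) t ≤ C := by
  obtain ⟨η, hη0, hη1, hη⟩ := S.exists_derivNorm_initialMap_le
  set ρ : ℝ≥0 := η ^ (t - s)
  have hρ : 0 < ρ := NNReal.rpow_pos hη0
  have hρ1 : ρ < 1 := NNReal.rpow_lt_one hη1 (sub_pos.2 hst)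
  have hexp : ∀ n : ℕ, ENNReal.ofReal (Real.exp (-Real.log ρ * n)) = (ρ⁻¹ ^ n : ℝ≥0) := fun n => by
    rw [← Real.log_inv, mul_comm, Real.exp_nat_mul, Real.exp_log (by positivity),
      ENNReal.ofReal_pow (by positivity), ← NNReal.coe_inv, ENNReal.ofReal_coe_nnreal,
      ENNReal.coe_pow]
  rw [← EReal.coe_zero, lt_lowerPressure_iff] at hP
  push Not at hP
  have hfreq := hP _ (neg_pos.2 (Real.log_neg hρ hρ1))
  rw [← map_add_atTop_eq_nat 1, frequently_map] at hfreq
  refine ⟨(ρ⁻¹ : ℝ≥0), ENNReal.coe_ne_top, (hfreq.and_eventually hη).mono fun n hn => ?_⟩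
  calc S.Z (n + 1) t ≤ ((η : ℝ≥0∞) ^ n) ^ (t - s) * S.Z (n + 1) s :=
        Z_le_rpow_mul_Z hn.2 hs hst.le
    _ ≤ ((η : ℝ≥0∞) ^ n) ^ (t - s) * (ρ⁻¹ ^ (n + 1) : ℝ≥0) := by
        gcongr
        exact hn.1.le.trans_eq (hexp _)
    _ = (ρ ^ n * ρ⁻¹ ^ (n + 1) : ℝ≥0) := by
        rw [← ENNReal.rpow_natCast, ← ENNReal.rpow_mul, mul_comm (n : ℝ), ENNReal.rpow_mul,
          ENNReal.rpow_natCast, ← ENNReal.coe_rpow_of_ne_zero hη0.ne']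
        push_cast
        rfl
    _ = (ρ⁻¹ : ℝ≥0) := by rw [pow_succ, ← mul_assoc, ← mul_pow, mul_inv_cancel₀ hρ.ne', one_pow,
        one_mul]

theorem dimH_limitSet_le_bowenDim (hX : IsPhaseSpace X) : dimH S.limitSet ≤ S.bowenDim := by
  by_contra! hlt
  obtain ⟨s, hBs, hs⟩ := ENNReal.lt_iff_exists_nnreal_btwn.1 hlt
  obtain ⟨t, hst, ht⟩ := ENNReal.lt_iff_exists_nnreal_btwn.1 hs
  have hP : ¬ 0 < S.lowerPressure s := fun hpos => hBs.not_ge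
    (le_iSup₂ (f := fun (t : ℝ≥0) (_ : 0 < S.lowerPressure t) => (t : ℝ≥0∞)) s hpos)
  obtain ⟨C, hC, hfreq⟩ :=
    exists_frequently_Z_le s.coe_nonneg (t := t) (by exact_mod_cast hst) hP
  exact ht.not_ge (dimH_le_of_hausdorffMeasure_ne_top
    (hausdorffMeasure_limitSet_ne_top hX hC hfreq))

end NCIFS

/-! ### Transfer operators -/

theorem Word.tsum_preimage_init {I : ℕ → Set ℕ} {m n : ℕ} (A : Set (Word I m n))
    (G : Word I m (n + 1) → ℝ≥0∞) :
    ∑' ω : (Word.init ⁻¹' A : Set (Word I m (n + 1))), G ω =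
      ∑' (a : I (m + n)) (ω : A), G (Word.snocEquiv I m n (a, ω)) := by
  rw [tsum_subtype, ← (Word.snocEquiv I m n).tsum_eq, ENNReal.tsum_prod']
  refine tsum_congr fun a => ?_
  rw [tsum_subtype A fun ω => G (Word.snocEquiv I m n (a, ω))]
  refine tsum_congr fun ω => ?_
  have hmem : Word.snocEquiv I m n (a, ω) ∈ Word.init ⁻¹' A ↔ ω ∈ A := by
    rw [mem_preimage, Word.init_snocEquiv]
  by_cases hω : ω ∈ A
  · rw [indicator_of_mem hω, indicator_of_mem (hmem.2 hω)]
  · rw [indicator_of_notMem hω, indicator_of_notMem (mt hmem.1 hω)]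

namespace NCIFS

variable {d : ℕ} {X : Set (E d)} {S : NCIFS X} {K : ℝ≥0} {n : ℕ} {t : ℝ}

/-- The transfer operator of level `n` with exponent `t`; these operators turn `ZAt` at `n` into
`ZAt` at `n + 1`. -/
noncomputable def transfer (S : NCIFS X) (n : ℕ) (t : ℝ) (g : E d → ℝ≥0∞) (x : E d) : ℝ≥0∞ :=
  ∑' a : S.index n, ‖fderiv ℝ (S.map n a) x‖ₑ ^ t * g (S.map n a x)

/-- The sum `∑_{ω ∈ A} |Dφ_ω(x)|^t` over a set `A` of initial words. -/
noncomputable def wordSum (S : NCIFS X) {n : ℕ} (A : Set (Word S.index 0 n)) (t : ℝ) (x : E d) :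
    ℝ≥0∞ :=
  ∑' ω : A, ‖fderiv ℝ (S.initialMap n ω) x‖ₑ ^ t

/-- The pointwise variant `∑_{|ω| = n} |Dφ_ω(x)|^t` of `Z_n(t)`, which unlike `Z_n(t)` satisfies an
exact recursion in `n`. -/
noncomputable def ZAt (S : NCIFS X) (n : ℕ) (t : ℝ) (x : E d) : ℝ≥0∞ :=
  S.wordSum (univ : Set (Word S.index 0 n)) t x

theorem enorm_fderiv_initialMap_succ [Nontrivial (E d)] (ω : Word S.index 0 (n + 1)) {x : E d}
    (hx : x ∈ S.V) : ‖fderiv ℝ (S.initialMap (n + 1) ω) x‖ₑ =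
      ‖fderiv ℝ (S.initialMap n ω.init) (S.map (0 + n) ω.last x)‖ₑ *
        ‖fderiv ℝ (S.map (0 + n) ω.last) x‖ₑ := by
  have hinit : ConformalAt (S.initialMap n ω.init) (S.map (0 + n) ω.last x) :=
    conformalAt_wordMap S.mapsTo_V S.conformalAt_V ω.init (S.mapsTo_V _ _ hx)
  have hlast := S.conformalAt_V (0 + n) ω.last x hx
  rw [initialMap_succ, fderiv_comp x hinit.differentiableAt hlast.differentiableAt,
    ← ofReal_norm, norm_comp_of_isConformalMap (conformalAt_iff_isConformalMap_fderiv.1 hinit)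
      (conformalAt_iff_isConformalMap_fderiv.1 hlast), ENNReal.ofReal_mul (norm_nonneg _),
    ofReal_norm, ofReal_norm]

theorem wordSum_preimage_init [Nontrivial (E d)] (A : Set (Word S.index 0 n)) (ht : 0 ≤ t)
    {x : E d} (hx : x ∈ S.V) :
    S.wordSum (Word.init ⁻¹' A) t x = S.transfer n t (S.wordSum A t) x := by
  have h : S.wordSum (Word.init ⁻¹' A) t x = S.transfer (0 + n) t (S.wordSum A t) x := by
    rw [wordSum, Word.tsum_preimage_init A fun ω => ‖fderiv ℝ (S.initialMap (n + 1) ω) x‖ₑ ^ t]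
    simp only [enorm_fderiv_initialMap_succ _ hx, Word.init_snocEquiv, Word.last_snocEquiv,
      ENNReal.mul_rpow_of_nonneg _ _ ht, transfer, wordSum, ← ENNReal.tsum_mul_left, mul_comm]
  rwa [zero_add] at h

theorem ZAt_succ [Nontrivial (E d)] (ht : 0 ≤ t) {x : E d} (hx : x ∈ S.V) :
    S.ZAt (n + 1) t x = S.transfer n t (S.ZAt n t) x :=
  wordSum_preimage_init univ ht hx

theorem initialMap_zero (ω : Word S.index 0 0) : S.initialMap 0 ω = id := rfl

theorem ZAt_zero [Nontrivial (E d)] (x : E d) : S.ZAt 0 t x = 1 := by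
  have : Unique (Word S.index 0 0) := Pi.uniqueOfIsEmpty _
  rw [ZAt, wordSum, tsum_univ fun ω => ‖fderiv ℝ (S.initialMap 0 ω) x‖ₑ ^ t, tsum_fintype,
    Fintype.sum_unique, initialMap_zero, fderiv_id, ← ofReal_norm, ContinuousLinearMap.norm_id,
    ENNReal.ofReal_one, ENNReal.one_rpow]

theorem derivNorm_initialMap_zero [Nontrivial (E d)] (hne : X.Nonempty) (ω : Word S.index 0 0) :
    derivNorm X (S.initialMap 0 ω) = 1 := by
  simp [derivNorm, initialMap_zero, fderiv_id, ← ofReal_norm, ContinuousLinearMap.norm_id,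
    biSup_const hne]

theorem IsDistortion.wordSum_le (hK : S.IsDistortion K) (A : Set (Word S.index 0 n)) (ht : 0 ≤ t)
    {x y : E d} (hx : x ∈ S.V) (hy : y ∈ S.V) :
    S.wordSum A t x ≤ (K : ℝ≥0∞) ^ t * S.wordSum A t y := by
  rw [wordSum, wordSum, ← ENNReal.tsum_mul_left]
  refine ENNReal.tsum_le_tsum fun ω => ?_
  rw [← ENNReal.mul_rpow_of_nonneg _ _ ht]
  exact ENNReal.rpow_le_rpow ((hK.initialMap n ω).enorm_fderiv_le x hx y hy) ht

theorem ZAt_le_Z (ht : 0 ≤ t) {x : E d} (hx : x ∈ X) : S.ZAt n t x ≤ S.Z n t := by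
  rw [ZAt, wordSum, tsum_univ fun ω => ‖fderiv ℝ (S.initialMap n ω) x‖ₑ ^ t]
  exact ENNReal.tsum_le_tsum fun ω => ENNReal.rpow_le_rpow (enorm_fderiv_le_derivNorm hx) ht

theorem IsDistortion.Z_le (hK : S.IsDistortion K) (ht : 0 ≤ t) {x : E d} (hx : x ∈ S.V) :
    S.Z n t ≤ (K : ℝ≥0∞) ^ t * S.ZAt n t x := by
  rw [ZAt, wordSum, tsum_univ fun ω => ‖fderiv ℝ (S.initialMap n ω) x‖ₑ ^ t, Z,
    ← ENNReal.tsum_mul_left]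
  refine ENNReal.tsum_le_tsum fun ω => ?_
  rw [← ENNReal.mul_rpow_of_nonneg _ _ ht]
  exact ENNReal.rpow_le_rpow ((hK.initialMap n ω).derivNorm_le S.subset_V hx) ht

theorem transfer_mono {g h : E d → ℝ≥0∞} (hgh : ∀ y ∈ X, g y ≤ h y) {x : E d} (hx : x ∈ X) :
    S.transfer n t g x ≤ S.transfer n t h x :=
  ENNReal.tsum_le_tsum fun a => by gcongr; exact hgh _ (S.mapsTo_X n a hx)

theorem transfer_const_mul (c : ℝ≥0∞) (g : E d → ℝ≥0∞) (x : E d) :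
    S.transfer n t (fun y => c * g y) x = c * S.transfer n t g x := by
  simp only [transfer, mul_left_comm _ c, ENNReal.tsum_mul_left]

theorem transfer_restrict_add_transfer_restrict_compl (F : ℕ → Set ℕ) (g : E d → ℝ≥0∞)
    (x : E d) : (S.restrict F).transfer n t g x + (S.restrict fun n => (F n)ᶜ).transfer n t g x =
      S.transfer n t g x :=
  tsum_inclusion_add_tsum_inclusion_compl (S.index n) (F n)
    fun a => ‖fderiv ℝ (S.map n a) x‖ₑ ^ t * g (S.map n a x)

theorem transfer_le {g : E d → ℝ≥0∞} {b : ℝ≥0∞} (hg : ∀ y ∈ X, g y ≤ b) (ht : 0 ≤ t) {x : E d}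
    (hx : x ∈ X) : S.transfer n t g x ≤ S.levelSum n t * b := by
  rw [transfer, levelSum, ← ENNReal.tsum_mul_right]
  exact ENNReal.tsum_le_tsum fun a => mul_le_mul'
    (ENNReal.rpow_le_rpow (enorm_fderiv_le_derivNorm hx) ht) (hg _ (S.mapsTo_X n a hx))

theorem IsDistortion.levelSum_mul_le (hK : S.IsDistortion K) {g : E d → ℝ≥0∞} {b : ℝ≥0∞}
    (hg : ∀ y ∈ X, b ≤ g y) (ht : 0 ≤ t) {x : E d} (hx : x ∈ X) :
    S.levelSum n t * b ≤ (K : ℝ≥0∞) ^ t * S.transfer n t g x := by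
  rw [transfer, levelSum, ← ENNReal.tsum_mul_right, ← ENNReal.tsum_mul_left]
  refine ENNReal.tsum_le_tsum fun a => ?_
  rw [← mul_assoc, ← ENNReal.mul_rpow_of_nonneg _ _ ht]
  exact mul_le_mul' (ENNReal.rpow_le_rpow ((hK.map n a).derivNorm_le S.subset_V
    (S.subset_V hx)) ht) (hg _ (S.mapsTo_X n a hx))

end NCIFS

/-! ### The lower bound for slowly growing finite alphabets -/

theorem exists_coe_gt_rpow_le {D e : ℝ≥0∞} {t : ℝ} (ht : 0 < t) (hD : D ≠ ⊤) (he : e ≠ 0) :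
    ∃ r : ℝ≥0, D < r ∧ (r : ℝ≥0∞) ^ t ≤ D ^ t + e := by
  have hlt : D ^ t < D ^ t + e :=
    ENNReal.lt_add_right (ENNReal.rpow_ne_top_of_nonneg ht.le hD) he
  have hnear : ∀ᶠ x in 𝓝[>] D, x ^ t < D ^ t + e :=
    (ENNReal.continuous_rpow_const.continuousAt.eventually_lt_const hlt).filter_mono
      nhdsWithin_le_nhds
  have : (𝓝[>] D).NeBot := nhdsGT_neBot_of_exists_gt ⟨⊤, hD.lt_top⟩
  obtain ⟨x, hx, hDx⟩ := (hnear.and self_mem_nhdsWithin).exists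
  obtain ⟨r, hDr, hrx⟩ := ENNReal.lt_iff_exists_nnreal_btwn.1 (mem_Ioi.1 hDx)
  exact ⟨r, hDr, (ENNReal.rpow_le_rpow hrx.le ht.le).trans hx.le⟩

theorem exists_ball_cover_of_hausdorffMeasure_eq_zero {Y : Type*} [MetricSpace Y]
    [MeasurableSpace Y] [BorelSpace Y] [Nonempty Y] {s : Set Y} {t : ℝ} (ht : 0 < t)
    (hs : μH[t] s = 0) {ε : ℝ≥0∞} (hε : ε ≠ 0) :
    ∃ (c : ℕ → Y) (r : ℕ → ℝ≥0), (∀ i, 0 < r i) ∧ s ⊆ ⋃ i, Metric.ball (c i) (r i) ∧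
      ∑' i, (r i : ℝ≥0∞) ^ t ≤ ε := by
  have hε2 : ε / 2 ≠ 0 := (ENNReal.half_pos hε).ne'
  obtain ⟨e, he, hesum⟩ := ENNReal.exists_pos_sum_of_countable' hε2 ℕ
  rw [Measure.hausdorffMeasure_apply] at hs
  have hlt := (ENNReal.iSup_eq_zero.1 (ENNReal.iSup_eq_zero.1 hs 1) one_pos).trans_lt
    (pos_iff_ne_zero.2 hε2)
  simp only [iInf_lt_iff] at hlt
  obtain ⟨u, hsu, hdiam, hsum⟩ := hlt
  have hball : ∀ i, ∃ (c : Y) (r : ℝ≥0), 0 < r ∧ u i ⊆ Metric.ball c r ∧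
      (r : ℝ≥0∞) ^ t ≤ (⨆ _ : (u i).Nonempty, Metric.ediam (u i) ^ t) + e i := by
    intro i
    obtain ⟨r, hdr, hr⟩ := exists_coe_gt_rpow_le ht
      ((hdiam i).trans_lt ENNReal.one_lt_top).ne (he i).ne'
    have hr0 : 0 < r := by exact_mod_cast pos_of_gt hdr
    rcases (u i).eq_empty_or_nonempty with hempty | ⟨c, hc⟩
    · refine ⟨Classical.arbitrary Y, r, hr0, by simp [hempty], hr.trans ?_⟩
      simp [hempty, ENNReal.zero_rpow_of_pos ht]
    · refine ⟨c, r, hr0, fun y hy => ?_, by rwa [iSup_pos ⟨c, hc⟩]⟩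
      have hyc := (Metric.edist_le_ediam_of_mem hy hc).trans_lt hdr
      rw [edist_nndist] at hyc
      exact_mod_cast hyc
  choose c r hr hur hrt using hball
  refine ⟨c, r, hr, hsu.trans (iUnion_mono hur), ?_⟩
  calc ∑' i, (r i : ℝ≥0∞) ^ t
      ≤ ∑' i, ((⨆ _ : (u i).Nonempty, Metric.ediam (u i) ^ t) + e i) := ENNReal.tsum_le_tsum hrt
    _ ≤ ε / 2 + ε / 2 := ENNReal.tsum_add.trans_le (add_le_add hsum.le hesum.le)
    _ = ε := ENNReal.add_halves ε

theorem tsum_ne_top_of_eventually_le {g h : ℕ → ℝ≥0∞} (hg : ∀ n, g n ≠ ⊤)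
    (hgh : ∀ᶠ n in atTop, g n ≤ h n) (hh : ∑' n, h n ≠ ⊤) : ∑' n, g n ≠ ⊤ := by
  obtain ⟨N, hN⟩ := eventually_atTop.1 hgh
  rw [← ENNReal.summable.sum_add_tsum_nat_add' (k := N)]
  refine ENNReal.add_ne_top.2 ⟨ENNReal.sum_ne_top.2 fun n _ => hg n, ne_top_of_le_ne_top hh ?_⟩
  exact (ENNReal.tsum_le_tsum fun n => hN (n + N) le_add_self).trans
    (ENNReal.tsum_comp_le_tsum_of_injective (add_left_injective N) h)

/-- The sets `F n` are finite and have, from some `n` on, at most `exp (ε (n + 1))` elements; with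
`n + 1` the number of the level of index `n`, this is exponential growth at rate at most `ε`. -/
structure HasGrowthAtMost (F : ℕ → Set ℕ) (ε : ℝ) : Prop where
  finite : ∀ n, (F n).Finite
  encard_le : ∀ᶠ n : ℕ in atTop, ((F n).encard : ℝ≥0∞) ≤ ENNReal.ofReal (Real.exp (ε * (n + 1)))

theorem HasGrowthAtMost.mono {F G : ℕ → Set ℕ} {ε : ℝ} (hF : HasGrowthAtMost F ε)
    (h : ∀ n, G n ⊆ F n) : HasGrowthAtMost G ε where
  finite n := (hF.finite n).subset (h n)
  encard_le := hF.encard_le.mono fun n hn => by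
    refine le_trans ?_ hn
    exact_mod_cast encard_le_encard (h n)

namespace NCIFS

variable {d : ℕ} {X : Set (E d)} {S : NCIFS X} {K : ℝ≥0} {n : ℕ} {t : ℝ}

/-- The words reaching size at most `r` exactly with their last letter, among those whose parent is
large at scale `r` around `c`. -/
def newWords (S : NCIFS X) (c : E d) (r : ℝ≥0) (n : ℕ) : Set (Word S.index 0 (n + 1)) :=
  {ω | ω.init ∈ S.largeWords c r n ∧ derivNorm X (S.initialMap (n + 1) ω) ≤ r}

/-- The words of length `n` with a prefix in `newWords c r`. -/
def smallWords (S : NCIFS X) (c : E d) (r : ℝ≥0) : (n : ℕ) → Set (Word S.index 0 n)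
  | 0 => ∅
  | n + 1 => Word.init ⁻¹' smallWords S c r n ∪ S.newWords c r n

theorem mem_smallWords_or_mem_largeWords [Nontrivial (E d)] (hne : X.Nonempty) {c : E d}
    {r : ℝ≥0} (hr : r < 1) : ∀ (n : ℕ) (ω : Word S.index 0 n),
    (S.initialMap n ω '' X ∩ Metric.ball c r).Nonempty →
      ω ∈ S.smallWords c r n ∨ ω ∈ S.largeWords c r n
  | 0, ω, h => by
    refine Or.inr ⟨?_, h⟩
    rw [derivNorm_initialMap_zero hne]
    exact_mod_cast hr
  | n + 1, ω, h => by
    have hparent : S.initialMap (n + 1) ω '' X ⊆ S.initialMap n ω.init '' X := by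
      rw [initialMap_succ, image_comp]
      exact image_mono (S.mapsTo_X _ _).image_subset
    rcases mem_smallWords_or_mem_largeWords hne hr n ω.init
      (h.mono (inter_subset_inter_left _ hparent)) with hsmall | hlarge
    · exact Or.inl (Or.inl hsmall)
    · rcases le_or_gt (derivNorm X (S.initialMap (n + 1) ω)) r with hle | hgt
      · exact Or.inl (Or.inr ⟨hlarge, hle⟩)
      · exact Or.inr ⟨hgt, h⟩

theorem wordSum_newWords_le {N₀ : ℝ≥0∞} {c : E d} {r : ℝ≥0}
    (hN₀ : ((S.largeWords c r n).encard : ℝ≥0∞) ≤ N₀) (ht : 0 ≤ t) {x : E d} (hx : x ∈ X) :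
    S.wordSum (S.newWords c r n) t x ≤ (S.index n).encard * (N₀ * (r : ℝ≥0∞) ^ t) := by
  calc S.wordSum (S.newWords c r n) t x
      ≤ ∑' _ : S.newWords c r n, (r : ℝ≥0∞) ^ t := ENNReal.tsum_le_tsum fun ω =>
        ENNReal.rpow_le_rpow ((enorm_fderiv_le_derivNorm hx).trans ω.2.2) ht
    _ ≤ ∑' _ : (Word.init ⁻¹' S.largeWords c r n : Set (Word S.index 0 (n + 1))),
          (r : ℝ≥0∞) ^ t :=
        ENNReal.tsum_mono_subtype (fun _ => (r : ℝ≥0∞) ^ t) fun _ hω => hω.1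
    _ = (S.index (0 + n)).encard * ((S.largeWords c r n).encard * (r : ℝ≥0∞) ^ t) := by
        rw [Word.tsum_preimage_init _ fun _ => (r : ℝ≥0∞) ^ t]
        simp only [ENNReal.tsum_set_const]
    _ ≤ (S.index n).encard * (N₀ * (r : ℝ≥0∞) ^ t) := by
        rw [zero_add]
        gcongr

theorem IsDistortion.wordSum_smallWords_le [Nontrivial (E d)] (hK : S.IsDistortion K)
    {N₀ : ℝ≥0∞} {c : E d} {r : ℝ≥0} (hN₀ : ∀ n, ((S.largeWords c r n).encard : ℝ≥0∞) ≤ N₀)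
    (ht : 0 ≤ t) (hpos : ∀ n, S.Z n t ≠ 0) (hfin : ∀ n, S.Z n t ≠ ⊤) (n : ℕ) {x : E d}
    (hx : x ∈ X) : S.wordSum (S.smallWords c r n) t x ≤
      N₀ * (K : ℝ≥0∞) ^ t * (∑ k ∈ Finset.range n, (S.index k).encard / S.Z (k + 1) t) *
        (r : ℝ≥0∞) ^ t * S.ZAt n t x := by
  induction n generalizing x with
  | zero => simp [smallWords, wordSum]
  | succ n ih =>
    have hxV := S.subset_V hx
    have hold : S.wordSum (Word.init ⁻¹' S.smallWords c r n) t x ≤ N₀ * (K : ℝ≥0∞) ^ t *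
        (∑ k ∈ Finset.range n, (S.index k).encard / S.Z (k + 1) t) * (r : ℝ≥0∞) ^ t *
          S.ZAt (n + 1) t x := by
      rw [wordSum_preimage_init _ ht hxV, ZAt_succ ht hxV, ← transfer_const_mul]
      exact transfer_mono (fun y hy => ih hy) hx
    have hnew : S.wordSum (S.newWords c r n) t x ≤ N₀ * (K : ℝ≥0∞) ^ t *
        ((S.index n).encard / S.Z (n + 1) t) * (r : ℝ≥0∞) ^ t * S.ZAt (n + 1) t x := by
      calc S.wordSum (S.newWords c r n) t x
          ≤ (S.index n).encard * (N₀ * (r : ℝ≥0∞) ^ t) := wordSum_newWords_le (hN₀ n) ht hx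
        _ = (S.index n).encard * (N₀ * (r : ℝ≥0∞) ^ t) * (S.Z (n + 1) t / S.Z (n + 1) t) := by
            rw [ENNReal.div_self (hpos _) (hfin _), mul_one]
        _ ≤ (S.index n).encard * (N₀ * (r : ℝ≥0∞) ^ t) *
              ((K : ℝ≥0∞) ^ t * S.ZAt (n + 1) t x / S.Z (n + 1) t) := by
            gcongr
            exact hK.Z_le ht hxV
        _ = _ := by
            simp only [div_eq_mul_inv]
            ring
    calc S.wordSum (S.smallWords c r (n + 1)) t x
        ≤ S.wordSum (Word.init ⁻¹' S.smallWords c r n) t x + S.wordSum (S.newWords c r n) t x :=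
          ENNReal.tsum_union_le (fun ω => ‖fderiv ℝ (S.initialMap (n + 1) ω) x‖ₑ ^ t) _ _
      _ ≤ _ := add_le_add hold hnew
      _ = _ := by
          rw [Finset.sum_range_succ]
          ring

theorem IsDistortion.Z_succ_le [Nontrivial (E d)] (hK : S.IsDistortion K) (hne : X.Nonempty)
    (ht : 0 ≤ t) (n : ℕ) :
    S.Z (n + 1) t ≤ (K : ℝ≥0∞) ^ t * (S.levelSum n t * S.Z n t) := by
  obtain ⟨x, hx⟩ := hne
  calc S.Z (n + 1) t ≤ (K : ℝ≥0∞) ^ t * S.ZAt (n + 1) t x := hK.Z_le ht (S.subset_V hx)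
    _ ≤ (K : ℝ≥0∞) ^ t * (S.levelSum n t * S.Z n t) := by
        rw [ZAt_succ ht (S.subset_V hx)]
        gcongr
        exact transfer_le (fun y hy => ZAt_le_Z ht hy) ht hx

theorem Z_zero [Nontrivial (E d)] (hne : X.Nonempty) : S.Z 0 t = 1 := by
  have : Unique (Word S.index 0 0) := Pi.uniqueOfIsEmpty _
  rw [Z, tsum_fintype, Fintype.sum_unique, derivNorm_initialMap_zero hne, ENNReal.one_rpow]

theorem Z_ne_top [Nontrivial (E d)] (hne : X.Nonempty) (ht : 0 ≤ t)
    (hfin : ∀ n, S.levelSum n t ≠ ⊤) (n : ℕ) : S.Z n t ≠ ⊤ := by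
  obtain ⟨K, hK⟩ := S.exists_isDistortion
  induction n with
  | zero => simp [Z_zero hne]
  | succ n ih =>
    exact ne_top_of_le_ne_top (ENNReal.mul_ne_top (ENNReal.rpow_ne_top_of_nonneg ht
      ENNReal.coe_ne_top) (ENNReal.mul_ne_top (hfin n) ih)) (hK.Z_succ_le hne ht n)

theorem Z_ne_zero_of_le [Nontrivial (E d)] (hne : X.Nonempty) (ht : 0 ≤ t) {m n : ℕ} (hmn : m ≤ n)
    (hn : S.Z n t ≠ 0) : S.Z m t ≠ 0 := by
  obtain ⟨K, hK⟩ := S.exists_isDistortion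
  induction hmn with
  | refl => exact hn
  | @step n _ ih =>
    refine ih fun hzero => hn (le_antisymm ((hK.Z_succ_le hne ht n).trans_eq ?_) zero_le)
    rw [hzero, mul_zero, mul_zero]

theorem levelSum_ne_top_of_finite [∀ n, Finite (S.index n)] (hne : X.Nonempty) (ht : 0 ≤ t)
    (n : ℕ) : S.levelSum n t ≠ ⊤ := by
  obtain ⟨K, hK⟩ := S.exists_isDistortion
  have := Fintype.ofFinite (S.index n)
  rw [levelSum, tsum_fintype]
  exact ENNReal.sum_ne_top.2 fun a _ =>
    ENNReal.rpow_ne_top_of_nonneg ht ((hK.map n a).derivNorm_ne_top S.subset_V hne)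

theorem exists_finset_image_initialMap_subset [∀ n, Finite (S.index n)] (hX : IsCompact X)
    {ι : Type*} {U : ι → Set (E d)} (hU : ∀ i, IsOpen (U i)) (hcov : S.limitSet ⊆ ⋃ i, U i) :
    ∃ s : Finset ι, ∀ᶠ n in atTop, ∀ ω : Word S.index 0 (n + 1),
      S.initialMap (n + 1) ω '' X ⊆ ⋃ i ∈ s, U i := by
  set stage : ℕ → Set (E d) := fun n => ⋃ ω : Word S.index 0 (n + 1), S.initialMap (n + 1) ω '' X
  have hanti : Antitone stage := by
    refine antitone_nat_of_succ_le fun n => iUnion_subset fun ω => ?_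
    rw [initialMap_succ, image_comp]
    exact (image_mono (S.mapsTo_X _ _).image_subset).trans
      (subset_iUnion (fun ω => S.initialMap (n + 1) ω '' X) ω.init)
  have hcompact : ∀ n, IsCompact (stage n) := fun n => isCompact_iUnion fun ω =>
    hX.image_of_continuousOn fun x hx => (conformalAt_wordMap S.mapsTo_V S.conformalAt_V ω
      (S.subset_V hx)).differentiableAt.continuousAt.continuousWithinAt
  obtain ⟨n₀, hn₀⟩ := exists_subset_nhds_of_isCompact hanti.directed_ge hcompact
    fun x hx => (isOpen_iUnion hU).mem_nhds (hcov hx)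
  obtain ⟨s, hs⟩ := (hcompact n₀).elim_finite_subcover U hU hn₀
  refine ⟨s, (eventually_ge_atTop n₀).mono fun n hn ω => ?_⟩
  exact (subset_iUnion (fun ω => S.initialMap (n + 1) ω '' X) ω).trans ((hanti hn).trans hs)

theorem IsDistortion.one_le_mul_sum_rpow [Nontrivial (E d)] (hK : S.IsDistortion K)
    (hne : X.Nonempty) {N₀ : ℝ≥0∞} {ι : Type*} {s : Finset ι} {c : ι → E d} {r : ι → ℝ≥0}
    (hr : ∀ i ∈ s, 0 < r i ∧ r i < 1)
    (hN₀ : ∀ i ∈ s, ∀ n, ((S.largeWords (c i) (r i) n).encard : ℝ≥0∞) ≤ N₀) (ht : 0 ≤ t)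
    (hpos : ∀ n, S.Z n t ≠ 0) (hfin : ∀ n, S.Z n t ≠ ⊤)
    (hcov : ∀ᶠ n in atTop, ∀ ω : Word S.index 0 (n + 1),
      S.initialMap (n + 1) ω '' X ⊆ ⋃ i ∈ s, Metric.ball (c i) (r i)) :
    1 ≤ N₀ * (K : ℝ≥0∞) ^ t * (∑' k, (S.index k).encard / S.Z (k + 1) t) *
      ∑ i ∈ s, (r i : ℝ≥0∞) ^ t := by
  obtain ⟨x, hx⟩ := hne
  obtain ⟨η, -, hη1, hη⟩ := S.exists_derivNorm_initialMap_le
  have hsmall : ∀ᶠ n : ℕ in atTop, ∀ i ∈ s, η ^ n < r i :=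
    (Filter.eventually_all_finset s).2 fun i hi =>
      (tendsto_pow_atTop_nhds_zero_of_lt_one zero_le hη1).eventually_lt_const (hr i hi).1
  obtain ⟨n, hcov, hη, hsmall⟩ := (hcov.and (hη.and hsmall)).exists
  have hmem : univ ⊆ ⋃ i ∈ s, S.smallWords (c i) (r i) (n + 1) := by
    intro ω _
    have hωx : S.initialMap (n + 1) ω x ∈ S.initialMap (n + 1) ω '' X := mem_image_of_mem _ hx
    obtain ⟨i, hi, hball⟩ := mem_iUnion₂.1 (hcov ω hωx)
    refine mem_iUnion₂.2 ⟨i, hi, (mem_smallWords_or_mem_largeWords ⟨x, hx⟩ (hr i hi).2 _ ω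
      ⟨_, hωx, hball⟩).resolve_right fun hlarge => hlarge.1.not_ge ((hη ω).trans ?_)⟩
    exact_mod_cast (hsmall i hi).le
  have hZ0 : S.ZAt (n + 1) t x ≠ 0 := fun h =>
    hpos (n + 1) (le_antisymm ((hK.Z_le ht (S.subset_V hx)).trans (by simp [h])) zero_le)
  have hZt : S.ZAt (n + 1) t x ≠ ⊤ := ne_top_of_le_ne_top (hfin _) (ZAt_le_Z ht hx)
  refine (ENNReal.mul_le_mul_iff_left hZ0 hZt).1 ?_
  calc 1 * S.ZAt (n + 1) t x
      ≤ ∑ i ∈ s, S.wordSum (S.smallWords (c i) (r i) (n + 1)) t x := by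
        let weight (ω : Word S.index 0 (n + 1)) := ‖fderiv ℝ (S.initialMap (n + 1) ω) x‖ₑ ^ t
        rw [one_mul, ZAt]
        exact (ENNReal.tsum_mono_subtype weight hmem).trans
          (ENNReal.tsum_biUnion_le weight s fun i => S.smallWords (c i) (r i) (n + 1))
    _ ≤ ∑ i ∈ s, N₀ * (K : ℝ≥0∞) ^ t * (∑' k, (S.index k).encard / S.Z (k + 1) t) *
          (r i : ℝ≥0∞) ^ t * S.ZAt (n + 1) t x :=
        Finset.sum_le_sum fun i hi =>
          (hK.wordSum_smallWords_le (hN₀ i hi) ht hpos hfin (n + 1) hx).trans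
            (by gcongr; exact ENNReal.sum_le_tsum _)
    _ = _ := by rw [← Finset.sum_mul, ← Finset.mul_sum]

theorem le_dimH_limitSet_of_tsum_ne_top [Nontrivial (E d)] [∀ n, Finite (S.index n)]
    (hX : IsPhaseSpace X) {t : ℝ≥0} (hpos : ∀ n, S.Z n t ≠ 0)
    (hsum : ∑' n, ((S.index n).encard : ℝ≥0∞) / S.Z (n + 1) t ≠ ⊤) :
    (t : ℝ≥0∞) ≤ dimH S.limitSet := by
  by_contra! hlt
  have ht : 0 < (t : ℝ) := by exact_mod_cast pos_of_gt hlt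
  obtain ⟨K, hK⟩ := S.exists_isDistortion
  obtain ⟨N₀, hN₀⟩ := S.exists_encard_largeWords_le hX
  set C : ℝ≥0∞ := N₀ * (K : ℝ≥0∞) ^ (t : ℝ) *
    ∑' n, ((S.index n).encard : ℝ≥0∞) / S.Z (n + 1) t
  have hCt : C ≠ ⊤ := ENNReal.mul_ne_top (ENNReal.mul_ne_top ENNReal.coe_ne_top
    (ENNReal.rpow_ne_top_of_nonneg ht.le ENNReal.coe_ne_top)) hsum
  obtain ⟨ε, hε, hCε⟩ := ENNReal.exists_nnreal_pos_mul_lt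
    (ENNReal.add_ne_top.2 ⟨hCt, ENNReal.one_ne_top⟩) one_ne_zero
  obtain ⟨c, r, hr, hcov, hsize⟩ := exists_ball_cover_of_hausdorffMeasure_eq_zero ht
    (hausdorffMeasure_of_dimH_lt hlt) (ENNReal.coe_ne_zero.2 hε.ne')
  have hCsize : (C + 1) * ∑' i, (r i : ℝ≥0∞) ^ (t : ℝ) < 1 :=
    (by gcongr : _ ≤ (C + 1) * (ε : ℝ≥0∞)).trans_lt (by rwa [mul_comm])
  have hr1 : ∀ i, r i < 1 := by
    intro i
    by_contra! h
    refine hCsize.not_ge ?_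
    calc (1 : ℝ≥0∞) ≤ (r i : ℝ≥0∞) ^ (t : ℝ) := ENNReal.one_le_rpow (by exact_mod_cast h) ht
      _ ≤ ∑' i, (r i : ℝ≥0∞) ^ (t : ℝ) := ENNReal.le_tsum i
      _ ≤ _ := le_mul_of_one_le_left zero_le le_add_self
  obtain ⟨s, hs⟩ := exists_finset_image_initialMap_subset hX.isCompact
    (fun _ => Metric.isOpen_ball) hcov
  refine hCsize.not_ge ?_
  calc 1 ≤ C * ∑ i ∈ s, (r i : ℝ≥0∞) ^ (t : ℝ) :=
        hK.one_le_mul_sum_rpow hX.nonempty (fun i _ => ⟨hr i, hr1 i⟩)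
          (fun i _ n => hN₀ n (c i) (r i) (hr i)) ht.le hpos
          (Z_ne_top hX.nonempty ht.le fun n => levelSum_ne_top_of_finite hX.nonempty ht.le n) hs
    _ ≤ _ := mul_le_mul' le_self_add (ENNReal.sum_le_tsum s)

theorem le_dimH_limitSet_of_lt_lowerPressure [Nontrivial (E d)] (hX : IsPhaseSpace X) {t : ℝ≥0}
    {ε : ℝ} (hgrowth : HasGrowthAtMost S.index ε) (hε : (ε : EReal) < S.lowerPressure t) :
    (t : ℝ≥0∞) ≤ dimH S.limitSet := by
  obtain ⟨a, hεa, ha⟩ := lt_lowerPressure_iff.1 hε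
  have hpos : ∀ n, S.Z n t ≠ 0 := by
    intro n
    obtain ⟨N, hnN, hN⟩ := ((eventually_ge_atTop n).and ha).exists
    exact Z_ne_zero_of_le hX.nonempty t.coe_nonneg hnN
      ((ENNReal.ofReal_pos.2 (Real.exp_pos _)).trans_le hN).ne'
  have : ∀ n, Finite (S.index n) := fun n => (hgrowth.finite n).to_subtype
  refine le_dimH_limitSet_of_tsum_ne_top hX hpos (tsum_ne_top_of_eventually_le
    (h := fun n => ENNReal.ofReal (Real.exp (ε - a)) ^ (n + 1)) (fun n => ?_) ?_ ?_)
  · refine ENNReal.div_ne_top ?_ (hpos _)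
    rw [(hgrowth.finite n).encard_eq_coe_toFinset_card]
    exact ENNReal.natCast_ne_top _
  · filter_upwards [hgrowth.encard_le, (tendsto_add_atTop_nat 1).eventually ha] with n hn hZ
    refine ENNReal.div_le_of_le_mul (hn.trans ?_)
    calc ENNReal.ofReal (Real.exp (ε * (n + 1)))
        = ENNReal.ofReal (Real.exp (ε - a)) ^ (n + 1) *
            ENNReal.ofReal (Real.exp (a * (n + 1 : ℕ))) := by
          rw [← ENNReal.ofReal_pow (Real.exp_pos _).le, ← ENNReal.ofReal_mul (by positivity),
            ← Real.exp_nat_mul, ← Real.exp_add]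
          congr 2
          push_cast
          ring
      _ ≤ _ := by gcongr
  · have hlt : ENNReal.ofReal (Real.exp (ε - a)) < 1 :=
      ENNReal.ofReal_lt_one.2 (Real.exp_lt_one_iff.2 (by linarith))
    rw [ENNReal.tsum_geometric_add_one]
    exact ENNReal.mul_ne_top ENNReal.ofReal_ne_top (ENNReal.inv_ne_top.2 (tsub_pos_of_lt hlt).ne')

end NCIFS

/-! ### Truncation of the alphabets -/

theorem exists_lt_one_le_one_sub_mul {p C : ℝ≥0∞} (hp : p < 1) (hC : C ≠ ⊤) :
    ∃ q < 1, p ≤ 1 - C * (1 - q) := by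
  obtain ⟨ε, hε, hCε⟩ := ENNReal.exists_nnreal_pos_mul_lt hC (tsub_pos_of_lt hp).ne'
  refine ⟨1 - ε, ENNReal.sub_lt_self ENNReal.one_ne_top one_ne_zero
    (ENNReal.coe_ne_zero.2 hε.ne'), ?_⟩
  calc p = 1 - (1 - p) := (ENNReal.sub_sub_cancel ENNReal.one_ne_top hp.le).symm
    _ ≤ 1 - C * (1 - (1 - ε)) :=
        tsub_le_tsub_left ((mul_le_mul_right tsub_tsub_le C).trans
          ((mul_comm C (ε : ℝ≥0∞)).trans_le hCε.le)) 1

namespace NCIFS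

variable {d : ℕ} {X : Set (E d)} {S : NCIFS X} {K : ℝ≥0} {n : ℕ} {t : ℝ} {F : ℕ → Set ℕ}

theorem lt_lowerPressure_of_le_mul {a b : ℝ} (hba : b < a) {C : ℝ≥0∞} (hC : C ≠ ⊤)
    (h : ∀ᶠ n : ℕ in atTop, ENNReal.ofReal (Real.exp (a * n)) ≤ C * S.Z n t) :
    (b : EReal) < S.lowerPressure t := by
  obtain ⟨a', hba', ha'⟩ := exists_between hba
  refine lt_lowerPressure_iff.2 ⟨a', hba', ?_⟩
  have hexp : ∀ᶠ n : ℕ in atTop, C.toReal ≤ Real.exp ((a - a') * n) :=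
    (Real.tendsto_exp_atTop.comp (tendsto_natCast_atTop_atTop.const_mul_atTop
      (sub_pos.2 ha'))).eventually_ge_atTop _
  filter_upwards [h, hexp] with n hn hCn
  have hsplit : Real.exp (a * n) = Real.exp ((a - a') * n) * Real.exp (a' * n) := by
    rw [← Real.exp_add]
    ring_nf
  refine (ENNReal.mul_le_mul_iff_right (ENNReal.ofReal_pos.2 (Real.exp_pos ((a - a') * n))).ne'
    ENNReal.ofReal_ne_top).1 ?_
  rw [← ENNReal.ofReal_mul (Real.exp_pos _).le, ← hsplit]
  exact hn.trans (mul_le_mul_left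
    ((ENNReal.le_ofReal_iff_toReal_le hC (Real.exp_pos _).le).2 hCn) _)

theorem levelSum_restrict_compl_le {q : ℝ≥0∞} (hfin : S.levelSum n t ≠ ⊤)
    (hq : q * S.levelSum n t ≤ (S.restrict F).levelSum n t) :
    (S.restrict fun n => (F n)ᶜ).levelSum n t ≤ (1 - q) * S.levelSum n t := by
  have hsplit := levelSum_restrict_add_levelSum_restrict_compl (S := S) F n t
  rw [ENNReal.sub_mul fun _ _ => hfin, one_mul]
  exact (ENNReal.eq_sub_of_add_eq' hfin ((add_comm _ _).trans hsplit)).trans_le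
    (tsub_le_tsub_left hq _)

theorem IsDistortion.one_sub_mul_transfer_le (hK : S.IsDistortion K) (ht : 0 ≤ t)
    {g : E d → ℝ≥0∞} (hg : ∀ x ∈ X, ∀ y ∈ X, g x ≤ (K : ℝ≥0∞) ^ t * g y) {q : ℝ≥0∞}
    (hfin : S.levelSum n t ≠ ⊤) (hq : q * S.levelSum n t ≤ (S.restrict F).levelSum n t) {x : E d}
    (hx : x ∈ X) (hgx : S.transfer n t g x ≠ ⊤) :
    (1 - ((K : ℝ≥0∞) ^ t) ^ 3 * (1 - q)) * S.transfer n t g x ≤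
      (S.restrict F).transfer n t g x := by
  have hcompl : (S.restrict fun n => (F n)ᶜ).transfer n t g x ≤
      ((K : ℝ≥0∞) ^ t) ^ 3 * (1 - q) * S.transfer n t g x := by
    calc (S.restrict fun n => (F n)ᶜ).transfer n t g x
        ≤ (S.restrict fun n => (F n)ᶜ).levelSum n t * ((K : ℝ≥0∞) ^ t * g x) :=
          transfer_le (fun y hy => hg y hy x hx) ht hx
      _ ≤ (1 - q) * S.levelSum n t * ((K : ℝ≥0∞) ^ t * g x) := by
          gcongr
          exact levelSum_restrict_compl_le hfin hq
      _ = (K : ℝ≥0∞) ^ t * (1 - q) * (S.levelSum n t * g x) := by ring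
      _ ≤ (K : ℝ≥0∞) ^ t * (1 - q) *
            ((K : ℝ≥0∞) ^ t * S.transfer n t (fun y => (K : ℝ≥0∞) ^ t * g y) x) :=
          mul_le_mul_right (hK.levelSum_mul_le (fun y hy => hg x hx y hy) ht hx) _
      _ = _ := by
          rw [transfer_const_mul]
          ring
  rw [ENNReal.sub_mul fun _ _ => hgx, one_mul, tsub_le_iff_right]
  exact (transfer_restrict_add_transfer_restrict_compl F g x).symm.trans_le
    (add_le_add_right hcompl _)

theorem IsDistortion.pow_mul_ZAt_le_ZAt_restrict [Nontrivial (E d)] (hK : S.IsDistortion K)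
    (ht : 0 ≤ t) {q : ℝ≥0∞} (hfin : ∀ n, S.levelSum n t ≠ ⊤)
    (hq : ∀ n, q * S.levelSum n t ≤ (S.restrict F).levelSum n t) (n : ℕ) {x : E d} (hx : x ∈ X) :
    (1 - ((K : ℝ≥0∞) ^ t) ^ 3 * (1 - q)) ^ n * S.ZAt n t x ≤ (S.restrict F).ZAt n t x := by
  induction n generalizing x with
  | zero => simp [ZAt_zero]
  | succ n ih =>
    have hxV := S.subset_V hx
    have hZ : S.transfer n t (S.ZAt n t) x ≠ ⊤ := by
      rw [← ZAt_succ ht hxV]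
      exact ne_top_of_le_ne_top (Z_ne_top ⟨x, hx⟩ ht hfin _) (ZAt_le_Z ht hx)
    rw [ZAt_succ ht hxV, ZAt_succ (S := S.restrict F) ht hxV, pow_succ, mul_assoc]
    calc _ ≤ (1 - ((K : ℝ≥0∞) ^ t) ^ 3 * (1 - q)) ^ n *
            (S.restrict F).transfer n t (S.ZAt n t) x := by
          gcongr
          exact hK.one_sub_mul_transfer_le ht
            (fun y hy z hz => hK.wordSum_le univ ht (S.subset_V hy) (S.subset_V hz))
            (hfin n) (hq n) hx hZ
      _ ≤ _ := by
          rw [← transfer_const_mul]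
          exact transfer_mono (fun y hy => ih hy) hx

theorem IsDistortion.pow_le_ZAt [Nontrivial (E d)] (hK : S.IsDistortion K) (ht : 0 ≤ t)
    {D : ℝ≥0∞} (hD : ∀ n, (K : ℝ≥0∞) ^ t * D ≤ S.levelSum n t) (n : ℕ) {x : E d} (hx : x ∈ X) :
    D ^ n ≤ S.ZAt n t x := by
  have hK0 : 0 < (K : ℝ≥0∞) ^ t :=
    ENNReal.rpow_pos_of_nonneg (by exact_mod_cast one_pos.trans_le hK.one_le) ht
  have hKt : (K : ℝ≥0∞) ^ t ≠ ⊤ := ENNReal.rpow_ne_top_of_nonneg ht ENNReal.coe_ne_top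
  induction n generalizing x with
  | zero => rw [ZAt_zero, pow_zero]
  | succ n ih =>
    refine (ENNReal.mul_le_mul_iff_right hK0.ne' hKt).1 ?_
    rw [ZAt_succ ht (S.subset_V hx)]
    calc (K : ℝ≥0∞) ^ t * D ^ (n + 1) = (K : ℝ≥0∞) ^ t * D * D ^ n := by ring
      _ ≤ S.levelSum n t * D ^ n := by
          gcongr
          exact hD n
      _ ≤ _ := hK.levelSum_mul_le (fun y hy => ih hy) ht hx

theorem exists_lt_one_lt_lowerPressure_restrict [Nontrivial (E d)] (hne : X.Nonempty)
    (ht : 0 ≤ t) (hfin : ∀ n, S.levelSum n t ≠ ⊤) {b : ℝ} (hb : (b : EReal) < S.lowerPressure t) :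
    ∃ q < 1, ∀ F : ℕ → Set ℕ, (∀ n, q * S.levelSum n t ≤ (S.restrict F).levelSum n t) →
      (b : EReal) < (S.restrict F).lowerPressure t := by
  obtain ⟨K, hK⟩ := S.exists_isDistortion
  obtain ⟨x, hx⟩ := hne
  have hKt : (K : ℝ≥0∞) ^ t ≠ ⊤ := ENNReal.rpow_ne_top_of_nonneg ht ENNReal.coe_ne_top
  obtain ⟨a, hba, ha⟩ := lt_lowerPressure_iff.1 hb
  obtain ⟨a', hba', ha'⟩ := exists_between hba
  obtain ⟨q, hq, hpq⟩ := exists_lt_one_le_one_sub_mul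
    (ENNReal.ofReal_lt_one.2 (Real.exp_lt_one_iff.2 (sub_neg.2 ha')))
    (ENNReal.pow_ne_top hKt (n := 3))
  refine ⟨q, hq, fun F hF => lt_lowerPressure_of_le_mul hba' hKt ?_⟩
  filter_upwards [ha] with n hn
  calc ENNReal.ofReal (Real.exp (a' * n))
      = ENNReal.ofReal (Real.exp (a' - a)) ^ n * ENNReal.ofReal (Real.exp (a * n)) := by
        rw [← ENNReal.ofReal_pow (Real.exp_pos _).le, ← ENNReal.ofReal_mul (by positivity),
          ← Real.exp_nat_mul, ← Real.exp_add]
        ring_nf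
    _ ≤ (1 - ((K : ℝ≥0∞) ^ t) ^ 3 * (1 - q)) ^ n * ((K : ℝ≥0∞) ^ t * S.ZAt n t x) :=
        mul_le_mul' (pow_le_pow_left' hpq n) (hn.trans (hK.Z_le ht (S.subset_V hx)))
    _ = (K : ℝ≥0∞) ^ t * ((1 - ((K : ℝ≥0∞) ^ t) ^ 3 * (1 - q)) ^ n * S.ZAt n t x) :=
        mul_left_comm _ _ _
    _ ≤ (K : ℝ≥0∞) ^ t * (S.restrict F).Z n t := by
        gcongr
        exact (hK.pow_mul_ZAt_le_ZAt_restrict ht hfin hF n hx).trans (ZAt_le_Z ht hx)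

theorem exists_lt_lowerPressure_of_le_levelSum [Nontrivial (E d)] (hne : X.Nonempty)
    (ht : 0 ≤ t) (b : ℝ) : ∃ D : ℝ≥0, ∀ F : ℕ → Set ℕ,
      (∀ n, D ≤ (S.restrict F).levelSum n t) → (b : EReal) < (S.restrict F).lowerPressure t := by
  obtain ⟨K, hK⟩ := S.exists_isDistortion
  obtain ⟨x, hx⟩ := hne
  refine ⟨K ^ t * (Real.exp (b + 1)).toNNReal, fun F hF => ?_⟩
  refine lt_lowerPressure_iff.2 ⟨b + 1, by linarith, Eventually.of_forall fun n => ?_⟩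
  rw [mul_comm, Real.exp_nat_mul, ENNReal.ofReal_pow (Real.exp_pos _).le]
  refine ((hK.restrict F).pow_le_ZAt ht (fun n => le_trans (le_of_eq ?_) (hF n)) n hx).trans
    (ZAt_le_Z ht hx)
  rw [ENNReal.coe_mul, ENNReal.coe_rpow_of_nonneg _ ht, ENNReal.ofReal]

theorem bowenFormula_of_truncation [Nontrivial (E d)] (hX : IsPhaseSpace X)
    (h : ∀ t : ℝ, 0 < t → t < d → ∀ ε : ℝ, 0 < ε →
      ((∀ n, S.levelSum n t ≠ ⊤) ∧ ∀ q < 1, ∃ F, HasGrowthAtMost F ε ∧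
        ∀ n, q * S.levelSum n t ≤ (S.restrict F).levelSum n t) ∨
      ∀ D : ℝ≥0, ∃ F, HasGrowthAtMost F ε ∧ ∀ n, D ≤ (S.restrict F).levelSum n t) :
    S.BowenFormula := by
  refine le_antisymm (dimH_limitSet_le_bowenDim hX) (iSup₂_le fun t hP => ?_)
  rcases (zero_le (a := t)).eq_or_lt with rfl | ht
  · exact zero_le
  obtain ⟨ε, hε0, hεP⟩ := EReal.exists_between_coe_real hP
  have hε : 0 < ε := EReal.coe_pos.1 hε0
  suffices ∃ F, HasGrowthAtMost F ε ∧ (ε : EReal) < (S.restrict F).lowerPressure t by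
    obtain ⟨F, hF, hεF⟩ := this
    exact (le_dimH_limitSet_of_lt_lowerPressure hX (hF.mono fun n => inter_subset_right) hεF).trans
      (dimH_mono (limitSet_restrict_subset F))
  rcases h t ht (lt_of_lowerPressure_pos hX hP) ε hε with ⟨hfin, hF⟩ | hF
  · obtain ⟨q, hq, hqF⟩ := exists_lt_one_lt_lowerPressure_restrict hX.nonempty t.coe_nonneg hfin hεP
    obtain ⟨F, hgrowth, hF⟩ := hF q hq
    exact ⟨F, hgrowth, hqF F hF⟩
  · obtain ⟨D, hD⟩ := exists_lt_lowerPressure_of_le_levelSum (S := S) hX.nonempty t.coe_nonneg ε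
    obtain ⟨F, hgrowth, hF⟩ := hF D
    exact ⟨F, hgrowth, hD F hF⟩

end NCIFS

/-! ### The classes `𝓜`, `𝓜₊` and `EV` -/

theorem setOf_add_one_le (R : ℝ) : {k : ℕ | (k : ℝ) + 1 ≤ R} = Finset.range ⌊R⌋₊ := by
  ext k
  rw [mem_ofPred_eq, Finset.mem_coe, Finset.mem_range, ← Nat.succ_le_iff,
    Nat.le_floor_iff' k.succ_ne_zero, Nat.cast_succ]

theorem tendsto_exp_mul_add_one {ε : ℝ} (hε : 0 < ε) :
    Tendsto (fun n : ℕ => Real.exp (ε * (n + 1))) atTop atTop :=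
  Real.tendsto_exp_atTop.comp
    ((tendsto_atTop_add_const_right _ 1 tendsto_natCast_atTop_atTop).const_mul_atTop hε)

theorem hasGrowthAtMost_const {A : Set ℕ} (hA : A.Finite) {ε : ℝ} (hε : 0 < ε) :
    HasGrowthAtMost (fun _ => A) ε where
  finite _ := hA
  encard_le := by
    have hA' : ((A.encard : ℕ∞) : ℝ≥0∞) < ⊤ := by simpa using hA
    exact ((ENNReal.tendsto_ofReal_atTop.comp (tendsto_exp_mul_add_one hε)).eventually_const_lt
      hA').mono fun _ => le_of_lt

theorem hasGrowthAtMost_of_eventuallyEq {F : ℕ → Set ℕ} {ε : ℝ} (hfin : ∀ n, (F n).Finite)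
    (h : ∀ᶠ n in atTop, F n = {k : ℕ | (k : ℝ) + 1 ≤ Real.exp (ε * (n + 1))}) :
    HasGrowthAtMost F ε where
  finite := hfin
  encard_le := by
    filter_upwards [h] with n hn
    rw [hn, setOf_add_one_le, encard_coe_eq_coe_finsetCard, Finset.card_range, ENat.toENNReal_coe,
      ← ENNReal.ofReal_natCast]
    exact ENNReal.ofReal_le_ofReal (Nat.floor_le (Real.exp_pos _).le)

theorem tendsto_div_one_of_eventually_mul_le {ι : Type*} {l : Filter ι} {u T : ι → ℝ≥0∞}
    (hT0 : ∀ i, T i ≠ 0) (hT : ∀ i, T i ≠ ⊤) (huT : ∀ i, u i ≤ T i)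
    (h : ∀ q < 1, ∀ᶠ i in l, q * T i ≤ u i) : Tendsto (fun i => u i / T i) l (𝓝 1) := by
  refine tendsto_order.2 ⟨fun b hb => ?_, fun b hb => Eventually.of_forall fun i => ?_⟩
  · obtain ⟨q, hbq, hq⟩ := exists_between hb
    exact (h q hq).mono fun i hi =>
      hbq.trans_le ((ENNReal.le_div_iff_mul_le (Or.inl (hT0 i)) (Or.inl (hT i))).2 hi)
  · exact (ENNReal.div_le_of_le_mul ((huT i).trans_eq (one_mul _).symm)).trans_lt hb

theorem tendsto_div_one_of_add_eq {ι : Type*} {l : Filter ι} {u v T : ι → ℝ≥0∞}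
    (hT0 : ∀ i, T i ≠ 0) (hT : ∀ i, T i ≠ ⊤) (huv : ∀ i, u i + v i = T i)
    (h : Tendsto (fun i => v i / T i) l (𝓝 0)) : Tendsto (fun i => u i / T i) l (𝓝 1) := by
  have hv : ∀ i, v i / T i ≠ ⊤ := fun i =>
    ENNReal.div_ne_top (ne_top_of_le_ne_top (hT i) (huv i ▸ le_add_self)) (hT0 i)
  have hsub := ENNReal.Tendsto.sub (tendsto_const_nhds (x := (1 : ℝ≥0∞))) h
    (Or.inl ENNReal.one_ne_top)
  rw [tsub_zero] at hsub
  refine hsub.congr fun i => ?_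
  rw [← ENNReal.div_self (hT0 i) (hT i), ← huv i, ENNReal.add_div, huv i,
    ENNReal.add_sub_cancel_right (hv i)]

namespace NCIFS

variable {d : ℕ} {X : Set (E d)} {S : NCIFS X} {n : ℕ} {t ε : ℝ}

theorem levelSumUpTo_mono {R R' : ℝ} (h : R ≤ R') :
    S.levelSumUpTo n R t ≤ S.levelSumUpTo n R' t :=
  ENNReal.tsum_mono_subtype (fun k : S.index n => derivNorm X (S.map n k) ^ t)
    (fun _ hk => le_trans hk h)

theorem levelSumUpTo_le (R : ℝ) : S.levelSumUpTo n R t ≤ S.levelSum n t :=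
  ENNReal.tsum_comp_le_tsum_of_injective Subtype.val_injective
    fun k : S.index n => derivNorm X (S.map n k) ^ t

theorem IsInfinite.tsum_index (hS : S.IsInfinite) (n : ℕ) (g : ℕ → ℝ≥0∞) :
    ∑' k : S.index n, g k = ∑' k, g k := by
  rw [hS n, tsum_univ]

theorem levelSum_ne_zero [Nontrivial (E d)] (hne : X.Nonempty) (hS : S.IsInfinite) (ht : 0 ≤ t) :
    S.levelSum n t ≠ 0 := by
  obtain ⟨K, hK⟩ := S.exists_isDistortion
  refine fun h => ?_
  have hzero := ENNReal.tsum_eq_zero.1 h ⟨0, hS n ▸ mem_univ 0⟩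
  exact (ENNReal.rpow_pos_of_nonneg
    (pos_iff_ne_zero.2 ((hK.map n _).derivNorm_ne_zero S.subset_V hne)) ht).ne' hzero

theorem exists_finite_le_levelSum_restrict {b : ℝ≥0∞} (hb : b < S.levelSum n t) :
    ∃ A : Set ℕ, A.Finite ∧ b ≤ (S.restrict fun _ => A).levelSum n t := by
  rw [levelSum, ENNReal.tsum_eq_iSup_sum, lt_iSup_iff] at hb
  obtain ⟨s, hs⟩ := hb
  refine ⟨Subtype.val '' (s : Set (S.index n)), s.finite_toSet.image _, hs.le.trans ?_⟩
  calc ∑ a ∈ s, derivNorm X (S.map n a) ^ t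
      = ∑' a : s, derivNorm X (S.map n a) ^ t :=
        (s.tsum_subtype fun a => derivNorm X (S.map n a) ^ t).symm
    _ ≤ ∑' a : {a : S.index n | (a : ℕ) ∈ Subtype.val '' (s : Set (S.index n))},
          derivNorm X (S.map n a) ^ t :=
        ENNReal.tsum_mono_subtype (fun a => derivNorm X (S.map n a) ^ t)
          (subset_preimage_image Subtype.val (s : Set (S.index n)))
    _ = _ := (tsum_inclusion_inter _ _ fun a => derivNorm X (S.map n a) ^ t).symm

theorem exists_hasGrowthAtMost_le_levelSum_restrict {b : ℕ → ℝ≥0∞}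
    (hb : ∀ n, b n < S.levelSum n t)
    (hev : ∀ᶠ n : ℕ in atTop, b n ≤ S.levelSumUpTo n (Real.exp (ε * (n + 1))) t) :
    ∃ F, HasGrowthAtMost F ε ∧ ∀ n, b n ≤ (S.restrict F).levelSum n t := by
  choose A hA hbA using fun n => exists_finite_le_levelSum_restrict (hb n)
  obtain ⟨n₀, hn₀⟩ := eventually_atTop.1 hev
  set cutoff : ℕ → Set ℕ := fun n => {k | (k : ℝ) + 1 ≤ Real.exp (ε * (n + 1))}
  refine ⟨fun n => if n < n₀ then A n else cutoff n, hasGrowthAtMost_of_eventuallyEq (fun n => ?_)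
    ((eventually_ge_atTop n₀).mono fun n hn => if_neg hn.not_gt), fun n => ?_⟩
  · split_ifs
    · exact hA n
    · simp only [cutoff, setOf_add_one_le, Finset.finite_toSet]
  · change b n ≤ (S.restrict fun _ => if n < n₀ then A n else cutoff n).levelSum n t
    split_ifs with hn
    · exact hbA n
    · exact (hn₀ n (not_lt.1 hn)).trans_eq (levelSumUpTo_eq_levelSum_restrict _ _ _)

theorem InClassM.bowenFormula [Nontrivial (E d)] (hS : S.InClassM) (hX : IsPhaseSpace X) :
    S.BowenFormula := by
  refine bowenFormula_of_truncation hX fun t ht htd ε hε => ?_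
  obtain ⟨htop | hfin, htend, htend_top⟩ := hS.2 t ht htd ε hε
  · refine Or.inr fun D => exists_hasGrowthAtMost_le_levelSum_restrict
      (fun n => (htop n).symm ▸ ENNReal.coe_lt_top) ?_
    exact ((htend_top htop).eventually_const_lt ENNReal.coe_lt_top).mono fun _ => le_of_lt
  · refine Or.inl ⟨fun n => (hfin n).ne, fun q hq => exists_hasGrowthAtMost_le_levelSum_restrict
      (fun n => ?_) ?_⟩
    · simpa using ENNReal.mul_lt_mul_left (levelSum_ne_zero hX.nonempty hS.1 ht.le) (hfin n).ne hq
    · exact ((htend hfin).eventually_const_lt hq).mono fun _ h => ENNReal.mul_le_of_le_div h.le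

theorem InClassMPlus.exists_cutoff (hS : S.InClassMPlus) (ht : 0 ≤ t) (htd : t ≤ d) :
    ((∀ n, S.levelSum n t < ⊤) ∧
      ∀ q < 1, ∃ M : ℕ, ∀ n, q * S.levelSum n t ≤ S.levelSumUpTo n M t) ∨
    ((∀ n, S.levelSum n t = ⊤) ∧ ∀ D : ℝ≥0, ∃ M : ℕ, ∀ n, D ≤ S.levelSumUpTo n M t) := by
  have hM := hS.2.2.2 t ht htd
  obtain ⟨-, -, htop | hfin, -, -⟩ := hM 1 one_pos
  · refine Or.inr ⟨htop, fun D => ?_⟩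
    obtain ⟨M, -, -, -, hD⟩ := hM (1 / (D + 1)) (by positivity)
    refine ⟨M, fun n => le_trans ?_ (hD htop n)⟩
    rw [one_div_one_div, ← ENNReal.ofReal_coe_nnreal]
    exact ENNReal.ofReal_le_ofReal (by linarith)
  · refine Or.inl ⟨hfin, fun q hq => ?_⟩
    lift q to ℝ≥0 using hq.ne_top
    have hq' : (q : ℝ) < 1 := by exact_mod_cast hq
    obtain ⟨M, -, -, hMq, -⟩ := hM (1 - q) (sub_pos.2 hq')
    refine ⟨M, fun n => ?_⟩
    simpa only [sub_sub_cancel, ENNReal.ofReal_coe_nnreal] using hMq hfin n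

theorem InClassMPlus.bowenFormula [Nontrivial (E d)] (hS : S.InClassMPlus) (hX : IsPhaseSpace X) :
    S.BowenFormula := by
  refine bowenFormula_of_truncation hX fun t ht htd ε hε => ?_
  have hgrowth : ∀ M : ℕ, HasGrowthAtMost (fun _ => {k : ℕ | (k : ℝ) + 1 ≤ M}) ε := fun M =>
    hasGrowthAtMost_const (setOf_add_one_le M ▸ Finset.finite_toSet _) hε
  refine (hS.exists_cutoff ht.le htd.le).imp (fun ⟨hfin, hM⟩ => ⟨fun n => (hfin n).ne, ?_⟩)
    fun ⟨_, hM⟩ => ?_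
  · refine fun q hq => (hM q hq).imp' _ fun M hMq => ⟨hgrowth M, ?_⟩
    simpa only [levelSumUpTo_eq_levelSum_restrict] using hMq
  · refine fun D => (hM D).imp' _ fun M hMD => ⟨hgrowth M, ?_⟩
    simpa only [levelSumUpTo_eq_levelSum_restrict] using hMD

theorem InClassMPlus.inClassM [Nontrivial (E d)] (hS : S.InClassMPlus) (hne : X.Nonempty)
    (hinf : S.IsInfinite) : S.InClassM := by
  refine ⟨hinf, fun t ht htd ε hε => ?_⟩
  have hcutoff : ∀ M : ℕ, ∀ᶠ n : ℕ in atTop,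
      S.levelSumUpTo n M t ≤ S.levelSumUpTo n (Real.exp (ε * (n + 1))) t := fun M =>
    ((tendsto_exp_mul_add_one hε).eventually_ge_atTop (M : ℝ)).mono fun _ => levelSumUpTo_mono
  rcases hS.exists_cutoff ht.le htd.le with ⟨hfin, hM⟩ | ⟨htop, hM⟩
  · refine ⟨Or.inr hfin, fun _ => ?_, fun h => absurd (h 0) (hfin 0).ne⟩
    refine tendsto_div_one_of_eventually_mul_le (fun n => levelSum_ne_zero hne hinf ht.le)
      (fun n => (hfin n).ne) (fun n => levelSumUpTo_le _) fun q hq => ?_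
    obtain ⟨M, hMq⟩ := hM q hq
    exact (hcutoff M).mono fun n => (hMq n).trans
  · refine ⟨Or.inl htop, fun h => absurd (htop 0) (h 0).ne, fun _ => ?_⟩
    refine ENNReal.tendsto_nhds_top fun D => ?_
    obtain ⟨M, hMD⟩ := hM (D + 1)
    refine (hcutoff M).mono fun n hn => lt_of_lt_of_le ?_ ((hMD n).trans hn)
    exact_mod_cast D.lt_succ_self

/-- The letter norms `‖Dφ_i‖` agree with the weights `g i` up to the factor `C`, uniformly over all
levels. -/
structure IsComparable (S : NCIFS X) (g : ℕ → ℝ≥0∞) (C : ℝ≥0) : Prop where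
  derivNorm_le : ∀ (n : ℕ) (i : S.index n), derivNorm X (S.map n i) ≤ C * g i
  le_derivNorm : ∀ (n : ℕ) (i : S.index n), g i ≤ C * derivNorm X (S.map n i)

theorem EvenlyVarying.exists_isComparable (hS : S.EvenlyVarying) : ∃ g C, S.IsComparable g C := by
  obtain ⟨-, γ, c, -, hc, hγ⟩ := hS
  have hc0 : 0 < c := one_pos.trans_le hc
  refine ⟨fun i => ENNReal.ofReal (γ i), c.toNNReal, ⟨fun n i => ?_, fun n i => ?_⟩⟩
  · exact (hγ n i).2.trans_eq (ENNReal.ofReal_mul hc0.le)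
  · calc ENNReal.ofReal (γ i) = ENNReal.ofReal c * ENNReal.ofReal (γ i / c) := by
          rw [← ENNReal.ofReal_mul hc0.le, mul_div_cancel₀ _ hc0.ne']
      _ ≤ _ := mul_le_mul_right (hγ n i).1 _

namespace IsComparable

variable {g : ℕ → ℝ≥0∞} {C : ℝ≥0}

theorem restrict (h : S.IsComparable g C) (F : ℕ → Set ℕ) : (S.restrict F).IsComparable g C where
  derivNorm_le n _ := h.derivNorm_le n _
  le_derivNorm n _ := h.le_derivNorm n _

theorem levelSum_le (h : S.IsComparable g C) (ht : 0 ≤ t) :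
    S.levelSum n t ≤ (C : ℝ≥0∞) ^ t * ∑' k : S.index n, g k ^ t := by
  rw [← ENNReal.tsum_mul_left]
  refine ENNReal.tsum_le_tsum fun k => ?_
  rw [← ENNReal.mul_rpow_of_nonneg _ _ ht]
  exact ENNReal.rpow_le_rpow (h.derivNorm_le n k) ht

theorem tsum_div_le_levelSum (h : S.IsComparable g C) (ht : 0 ≤ t) :
    (∑' k : S.index n, g k ^ t) / (C : ℝ≥0∞) ^ t ≤ S.levelSum n t := by
  refine ENNReal.div_le_of_le_mul' ?_
  rw [levelSum, ← ENNReal.tsum_mul_left]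
  refine ENNReal.tsum_le_tsum fun k => ?_
  rw [← ENNReal.mul_rpow_of_nonneg _ _ ht]
  exact ENNReal.rpow_le_rpow (h.le_derivNorm n k) ht

theorem levelSum_eq_top_iff (h : S.IsComparable g C) (hinf : S.IsInfinite) (ht : 0 ≤ t) :
    S.levelSum n t = ⊤ ↔ ∑' k, g k ^ t = ⊤ := by
  have hCt : (C : ℝ≥0∞) ^ t ≠ ⊤ := ENNReal.rpow_ne_top_of_nonneg ht ENNReal.coe_ne_top
  have hle := h.levelSum_le (n := n) ht
  have hge := h.tsum_div_le_levelSum (n := n) ht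
  rw [hinf.tsum_index n fun k => g k ^ t] at hle hge
  refine ⟨fun htop => ?_, fun htop => ?_⟩
  · by_contra hne
    exact ENNReal.mul_ne_top hCt hne (top_le_iff.1 (htop ▸ hle))
  · rwa [htop, ENNReal.top_div_of_ne_top hCt, top_le_iff] at hge

theorem tendsto_levelSumUpTo_div_levelSum [Nontrivial (E d)] (h : S.IsComparable g C)
    (hne : X.Nonempty) (hinf : S.IsInfinite) (ht : 0 ≤ t) (hfin : ∀ n, S.levelSum n t ≠ ⊤)
    {R : ℕ → ℝ} (hR : Tendsto R atTop atTop) :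
    Tendsto (fun n => S.levelSumUpTo n (R n) t / S.levelSum n t) atTop (𝓝 1) := by
  have hCt : (C : ℝ≥0∞) ^ t ≠ ⊤ := ENNReal.rpow_ne_top_of_nonneg ht ENNReal.coe_ne_top
  have hpos : ∀ n, S.levelSum n t ≠ 0 := fun n => levelSum_ne_zero hne hinf ht
  have hsum : ∑' k, g k ^ t ≠ ⊤ := mt (h.levelSum_eq_top_iff hinf ht).2 (hfin 0)
  have hsum0 : (∑' k, g k ^ t) / (C : ℝ≥0∞) ^ t ≠ 0 := by
    refine ENNReal.div_ne_zero.2 ⟨fun h0 => hpos 0 (nonpos_iff_eq_zero.1 ?_), hCt⟩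
    simpa only [hinf.tsum_index 0 fun k => g k ^ t, h0, mul_zero] using h.levelSum_le (n := 0) ht
  have htail : Tendsto (fun n => ∑' k : ↥{k : ℕ | (k : ℝ) + 1 ≤ R n}ᶜ, g k ^ t) atTop (𝓝 0) := by
    refine ((ENNReal.tendsto_tsum_compl_atTop_zero hsum).comp
      (tendsto_finset_range.comp (tendsto_nat_floor_atTop.comp hR))).congr fun n => ?_
    rw [setOf_add_one_le]
    rfl
  refine tendsto_div_one_of_add_eq hpos hfin
    (v := fun n => (S.restrict fun _ => {k : ℕ | (k : ℝ) + 1 ≤ R n}ᶜ).levelSum n t) (fun n => ?_) ?_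
  · rw [levelSumUpTo_eq_levelSum_restrict]
    exact levelSum_restrict_add_levelSum_restrict_compl (fun _ => {k : ℕ | (k : ℝ) + 1 ≤ R n}) n t
  · have hlim := ENNReal.Tendsto.div_const (b := (∑' k, g k ^ t) / (C : ℝ≥0∞) ^ t)
      (ENNReal.Tendsto.const_mul (a := (C : ℝ≥0∞) ^ t) htail (Or.inr hCt)) (Or.inr hsum0)
    rw [mul_zero, ENNReal.zero_div] at hlim
    refine tendsto_of_tendsto_of_tendsto_of_le_of_le tendsto_const_nhds hlim
      (fun n => zero_le) fun n => ENNReal.div_le_div ?_ ?_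
    · refine ((h.restrict _).levelSum_le ht).trans (mul_le_mul_right ?_ _)
      exact ENNReal.tsum_mono_subtype (fun k => g k ^ t) inter_subset_right
    · simpa only [hinf.tsum_index n fun k => g k ^ t] using h.tsum_div_le_levelSum (n := n) ht

theorem tendsto_levelSumUpTo_top (h : S.IsComparable g C) (hinf : S.IsInfinite) (ht : 0 ≤ t)
    (htop : ∀ n, S.levelSum n t = ⊤) {R : ℕ → ℝ} (hR : Tendsto R atTop atTop) :
    Tendsto (fun n => S.levelSumUpTo n (R n) t) atTop (𝓝 ⊤) := by
  have hCt : (C : ℝ≥0∞) ^ t ≠ ⊤ := ENNReal.rpow_ne_top_of_nonneg ht ENNReal.coe_ne_top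
  have hpartial : Tendsto (fun n => ∑ k ∈ Finset.range ⌊R n⌋₊, g k ^ t) atTop (𝓝 ⊤) :=
    (h.levelSum_eq_top_iff hinf ht).1 (htop 0) ▸
      (ENNReal.tendsto_nat_tsum _).comp (tendsto_nat_floor_atTop.comp hR)
  have hlim := ENNReal.Tendsto.div_const (b := (C : ℝ≥0∞) ^ t) hpartial (Or.inl ENNReal.top_ne_zero)
  rw [ENNReal.top_div_of_ne_top hCt] at hlim
  refine tendsto_nhds_top_mono hlim (Eventually.of_forall fun n => ?_)
  have hle := (h.restrict fun _ => {k : ℕ | (k : ℝ) + 1 ≤ R n}).tsum_div_le_levelSum (n := n) ht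
  rw [← levelSumUpTo_eq_levelSum_restrict] at hle
  refine le_trans (ENNReal.div_le_div_right ?_ _) hle
  rw [← Finset.tsum_subtype', ← setOf_add_one_le]
  exact ENNReal.tsum_mono_subtype (fun k => g k ^ t)
    (subset_inter (hinf n ▸ subset_univ _) Subset.rfl)

end IsComparable

theorem EvenlyVarying.inClassM [Nontrivial (E d)] (hS : S.EvenlyVarying) (hne : X.Nonempty) :
    S.InClassM := by
  obtain ⟨g, C, h⟩ := hS.exists_isComparable
  refine ⟨hS.1, fun t ht _ ε hε => ⟨?_, fun hfin => ?_, fun htop => ?_⟩⟩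
  · simp only [lt_top_iff_ne_top, ne_eq, h.levelSum_eq_top_iff hS.1 ht.le, forall_const]
    exact em _
  · exact h.tendsto_levelSumUpTo_div_levelSum hne hS.1 ht.le (fun n => (hfin n).ne)
      (tendsto_exp_mul_add_one hε)
  · exact h.tendsto_levelSumUpTo_top hS.1 ht.le htop (tendsto_exp_mul_add_one hε)

end NCIFS

end NonAutonomous

theorem mainTheorem7 {d : ℕ} (hd : 0 < d) (X : Set (NonAutonomous.E d))
    (hX : NonAutonomous.IsPhaseSpace X) (S : NonAutonomous.NCIFS X) :
    (S.InClassM → S.BowenFormula) ∧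
    (S.EvenlyVarying → S.InClassM) ∧
    (S.EvenlyVarying → S.BowenFormula) ∧
    (S.InClassMPlus → S.IsInfinite → S.InClassM) ∧
    (S.InClassMPlus → S.BowenFormula) := by
  have : Nonempty (Fin d) := ⟨⟨0, hd⟩⟩
  have : Nontrivial (NonAutonomous.E d) := inferInstance
  exact ⟨fun hS => hS.bowenFormula hX, fun hS => hS.inClassM hX.nonempty,
    fun hS => (hS.inClassM hX.nonempty).bowenFormula hX,
    fun hS => hS.inClassM hX.nonempty, fun hS => hS.bowenFormula hX⟩
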